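/- Work on $\mathbb I=[0,1)$ with Lebesgue measure $\mu$. For $x\in\mathbb I$ let $x=\sum_{k\ge0}x_k2^{-(k+1)}$, $x_k\in\{0,1\}$, be its dyadic expansion (the one terminating in zeros if $x$ is a dyadic rational), and let $x\dotplus y:=\sum_{k\ge 0}|x_k-y_k|2^{-(k+1)}$. For $n\in\mathbb N=\{0,1,2,\dots\}$ write $n=\sum_k\varepsilon_k(n)2^k$ with $\varepsilon_k(n)\in\{0,1\}$, and let $|n|$ be the integer with $2^{|n|}\le n<2^{|n|+1}$ (with $|0|:=0$). Let $w_n(x)=(-1)^{\sum_k\varepsilon_k(n)x_k}$ be the Walsh–Paley functions, $D_n=\sum_{k=0}^{n-1}w_k$ the Dirichlet kernels, and $S_nf=\sum_{k=0}^{n-1}\widehat f(k)w_k$, $\widehat f(k)=\int_{\mathbb I}fw_k\,d\mu$, the partial sums of the Walsh–Fourier series of a real function $f\in L_1(\mathbb I)$. The dyadic Hardy space $H_1(\mathbb I)$ consists of the $f\in L_1(\mathbb I)$ with $\|f\|_{H_1}:=\|\sup_{n}|S_{2^n}f|\|_1<\infty$. Put $(f*g)(x)=\int_{\mathbb I}f(u)g(x\dotplus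 u)\,d\mu(u)$ and $\|F\|_{L_{1,\infty}}=\sup_{s>0}s\,\mu(|F|>s)$. A matrix of transformation is a real matrix $\mathbb T=(t_{k,n})_{k,n\in\mathbb N}$ with $0\le t_{k+1,n}\le t_{k,n}$ for all $k,n\in\mathbb N$ and $\sum_{k=0}^nt_{k,n}=1$ for all $n$. Let $$\mathcal T_n^{\mathbb T}f=\sum_{k=0}^nt_{n-k,n}S_kf,\qquad V_n^{\mathbb T}=\sum_{k=1}^nt_{n-k,n}D_k,\qquad \widetilde{\mathcal T}_n^{\mathbb T}f=f*|V_n^{\mathbb T}|,$$ $$\upsilon(n,\mathbb T)=\sum_{k=0}^{|n|}|\varepsilon_k(n)-\varepsilon_{k+1}(n)|\,\tau_{2^k,n},\qquad \tau_{s,n}=\sum_{l=0}^st_{l,n}.$$ **Proposition.** For every $M\in[0,\infty)$ there is a constant $C=C(M)\in[0,\infty)$ with the following property. Let $\mathbb T$ be a matrix of transformation and $(n_b)_{b\in\mathbb N}$ a sequence of natural numbers such that at least one of the following holds: (i) $\sup_{a}\|\mathcal T^{\mathbb T}_{n_a}\|_{H_1(\mathbb I)\to L_1(\mathbb I)}\le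 M$; (ii) $\sup_{a}\|\mathcal T^{\mathbb T}_{n_a}\|_{L_\infty(\mathbb I)\to L_\infty(\mathbb I)}\le M$; (iii) $\sup_{a}\upsilon(n_a,\mathbb T)\le M$. Then $$\Big\|\sup_{b\in\mathbb N}|\widetilde{\mathcal T}^{\mathbb T}_{n_b}f|\Big\|_{L_{1,\infty}(\mathbb I)}\le C\|f\|_1\quad(f\in L_1(\mathbb I)),\qquad \Big\|\sup_{b\in\mathbb N}|\widetilde{\mathcal T}^{\mathbb T}_{n_b}f|\Big\|_{\infty}\le C\|f\|_\infty\quad(f\in L_\infty(\mathbb I)).$$ In particular, if one of the three suprema is finite, then the maximal operator $f\mapsto\sup_b|\widetilde{\mathcal T}^{\mathbb T}_{n_b}f|$ is of weak type $(1,1)$ and bounded on $L_\infty(\mathbb I)$. -/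

import Mathlib

open MeasureTheory
open scoped NNReal ENNReal

noncomputable section

namespace WalshPaley

/-- Lebesgue measure on the unit interval `[0,1)`. Functions on `[0,1)` are represented by
functions on `ℝ`, of which only the values on `[0,1)` matter up to null sets. -/
def unitMeasure : Measure ℝ := volume.restrict (Set.Ico (0 : ℝ) 1)

/-- The `k`-th dyadic digit `x_k ∈ {0,1}` of `x = ∑ x_k 2^{-(k+1)}` in `[0,1)`
(for dyadic rationals, the expansion which terminates in zeros). -/
def digit (x : ℝ) (k : ℕ) : ℕ := (Real.digits x 2 k : ℕ)

/-- The dyadic sum `x ∔ y = ∑ |x_k - y_k| 2^{-(k+1)}`. -/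
def dyadicAdd (x y : ℝ) : ℝ :=
  ∑' k : ℕ, |(digit x k : ℝ) - (digit y k : ℝ)| * ((2 : ℝ) ^ (k + 1))⁻¹

/-- The binary coefficient `ε_k(n) ∈ {0,1}` of `n = ∑ ε_k(n) 2^k`. -/
def binCoeff (k n : ℕ) : ℕ := (n.testBit k).toNat

/-- The Rademacher function `ρ_k(x) = (-1)^{x_k}`. -/
def rademacher (k : ℕ) (x : ℝ) : ℝ := (-1) ^ digit x k

/-- The Walsh-Paley function `w_n = ∏_k ρ_k^{ε_k(n)}`; the factors with `k > |n| = Nat.log 2 n`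
are all equal to one. -/
def walsh (n : ℕ) (x : ℝ) : ℝ :=
  ∏ k ∈ Finset.range (Nat.log 2 n + 1), rademacher k x ^ binCoeff k n

/-- The Walsh-Dirichlet kernel `D_n = ∑_{k<n} w_k`. -/
def dirichletKernel (n : ℕ) (x : ℝ) : ℝ := ∑ k ∈ Finset.range n, walsh k x

/-- The Walsh-Fourier coefficient of `f`. -/
def fourierCoeff (f : ℝ → ℝ) (k : ℕ) : ℝ := ∫ x, f x * walsh k x ∂unitMeasure

/-- The partial sum `S_m f = ∑_{k<m} f^(k) w_k` of the Walsh-Fourier series. -/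
def partialSum (m : ℕ) (f : ℝ → ℝ) (x : ℝ) : ℝ :=
  ∑ k ∈ Finset.range m, fourierCoeff f k * walsh k x

/-- The matrices of transformation `(t_{k,n})`; the first index of `t` is `k`. -/
structure IsTransformationMatrix (t : ℕ → ℕ → ℝ) : Prop where
  nonneg : ∀ k n, 0 ≤ t k n
  antitone : ∀ k n, t (k + 1) n ≤ t k n
  sum_eq_one : ∀ n, ∑ k ∈ Finset.range (n + 1), t k n = 1

/-- The weighted means `∑_{k=0}^n t_{n-k,n} S_k f`. -/
def weightedMean (t : ℕ → ℕ → ℝ) (n : ℕ) (f : ℝ → ℝ) (x : ℝ) : ℝ :=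
  ∑ k ∈ Finset.range (n + 1), t (n - k) n * partialSum k f x

/-- The kernel `V_n = ∑_{k=1}^n t_{n-k,n} D_k`. -/
def kernelV (t : ℕ → ℕ → ℝ) (n : ℕ) (u : ℝ) : ℝ :=
  ∑ k ∈ Finset.Icc 1 n, t (n - k) n * dirichletKernel k u

/-- The dyadic convolution `(f * g)(x) = ∫ f(u) g(x ∔ u) du` over `[0,1)`. -/
def dyadicConv (f g : ℝ → ℝ) (x : ℝ) : ℝ := ∫ u, f u * g (dyadicAdd x u) ∂unitMeasure

/-- The operator `f ↦ f * |V_n|`. -/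
def absKernelMean (t : ℕ → ℕ → ℝ) (n : ℕ) (f : ℝ → ℝ) (x : ℝ) : ℝ :=
  dyadicConv f (fun u => |kernelV t n u|) x

/-- The maximal function `sup_b |f * |V_{n_b}||`, with values in `[0,∞]`. -/
def maximalFun (t : ℕ → ℕ → ℝ) (n : ℕ → ℕ) (f : ℝ → ℝ) (x : ℝ) : ℝ≥0∞ :=
  ⨆ b : ℕ, ‖absKernelMean t (n b) f x‖ₑ

/-- The weak `L₁` quasinorm `sup_{s>0} s μ(F > s)` over `[0,1)`. -/
def weakL1Norm (F : ℝ → ℝ≥0∞) : ℝ≥0∞ :=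
  ⨆ (s : ℝ≥0) (_ : 0 < s), (s : ℝ≥0∞) * unitMeasure {x | (s : ℝ≥0∞) < F x}

/-- The dyadic maximal function `E^* f = sup_n |S_{2^n} f|`. -/
def dyadicMaximal (f : ℝ → ℝ) (x : ℝ) : ℝ≥0∞ := ⨆ n : ℕ, ‖partialSum (2 ^ n) f x‖ₑ

/-- The dyadic Hardy norm `‖E^* f‖₁`. -/
def hardyNorm (f : ℝ → ℝ) : ℝ≥0∞ := ∫⁻ x, dyadicMaximal f x ∂unitMeasure

/-- Membership in the dyadic Hardy space `H₁`. -/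
def MemHardy (f : ℝ → ℝ) : Prop := Integrable f unitMeasure ∧ hardyNorm f < ∞

/-- The operator norm (possibly `∞`) from `H₁` to `L₁`. -/
def opNormHardyL1 (T : (ℝ → ℝ) → ℝ → ℝ) : ℝ≥0∞ :=
  sInf {K : ℝ≥0∞ | ∀ f : ℝ → ℝ, MemHardy f → eLpNorm (T f) 1 unitMeasure ≤ K * hardyNorm f}

/-- The operator norm (possibly `∞`) from `L_∞` to `L_∞`. -/
def opNormLinfty (T : (ℝ → ℝ) → ℝ → ℝ) : ℝ≥0∞ :=
  sInf {K : ℝ≥0∞ | ∀ f : ℝ → ℝ, MemLp f ∞ unitMeasure →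
    eLpNorm (T f) ∞ unitMeasure ≤ K * eLpNorm f ∞ unitMeasure}

/-- `τ_{s,n} = ∑_{l=0}^s t_{l,n}`. -/
def tau (t : ℕ → ℕ → ℝ) (s n : ℕ) : ℝ := ∑ l ∈ Finset.range (s + 1), t l n

/-- `υ(n,T) = ∑_{k=0}^{|n|} |ε_k(n) - ε_{k+1}(n)| τ_{2^k,n}`. -/
def upsilon (t : ℕ → ℕ → ℝ) (n : ℕ) : ℝ :=
  ∑ k ∈ Finset.range (Nat.log 2 n + 1),
    |(binCoeff k n : ℝ) - (binCoeff (k + 1) n : ℝ)| * tau t (2 ^ k) n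

end WalshPaley

end

namespace WalshPaley

/-! Everything passes through υ(n,T): a bound on υ gives both estimates, and each operator-norm
hypothesis bounds υ. Write F_m = ∑_{k<m} D_k.

Upper bound. Abel summation in the weights turns V_n into a positive combination of blocks ∑_{i≤j}
D_{n-i}. If b is the largest multiple of 2^l not exceeding n, with 2^l comparable to j+1, then each
D_{n-i} is D_b plus or minus a Walsh function times some D_m, so the block costs (j+1)|D_b| plus
Fejér sums F_m with m ≤ 2^l (`IsSign.abs_sum_signDirichlet_sub_le`). Moreover |D_b| ≤ D_{2^l} +
∑_{k≥l} |ε_k(n)-ε_{k+1}(n)| D_{2^{k+1}} (`IsSign.abs_signDirichlet_le`). So |V_n| is dominated by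
nonnegative multiples of D_{2^m} and 2^{-m}F_{2^m}, of total weight at most 17 + υ(n,T)
(`sum_truncDiff_bound_le`).

It remains to control two n-independent maximal functions of |f|: the dyadic one, and the one of
2^{-m}F_{2^m}, which is a mean, with weights 2^{i-m}, of averages over dyadic intervals with the
i-th digit flipped. A stopping time argument gives weak type (1,1) (`mul_measure_majorant_gt_le`);
the supremum bound is immediate.

Lower bound. A test function bounded by 1, equal on the shell [2^{-k-2}, 2^{-k-1}) to a Walsh
function adapted to the leading bits of n, pairs with V_n to at least (υ-2)/8 (`upsilon_le`). That
pairing is the value near 0 of the mean of the test function, so an L_∞ bound controls it. It is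
also the integral of the test function against the mean of the block ∑_{2^{|n|} ≤ i < 2^{|n|+1}}
w_i, whose Hardy norm is at most 1, so an H_1 to L_1 bound controls it too. -/

/-! ### Walsh, Dirichlet and Fejér kernels on sign sequences -/

/-- The Walsh function as a function of the sequence of values of the Rademacher functions. -/
noncomputable def signWalsh (n : ℕ) (r : ℕ → ℝ) : ℝ :=
  ∏ k ∈ Finset.range (Nat.log 2 n + 1), r k ^ binCoeff k n

/-- The Dirichlet kernel as a function of the Rademacher signs. -/
noncomputable def signDirichlet (n : ℕ) (r : ℕ → ℝ) : ℝ := ∑ k ∈ Finset.range n, signWalsh k r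

/-- The sum `∑_{k<n} D_k` as a function of the Rademacher signs. -/
noncomputable def signFejer (n : ℕ) (r : ℕ → ℝ) : ℝ := ∑ k ∈ Finset.range n, signDirichlet k r

/-- Sequences of signs. -/
def IsSign (r : ℕ → ℝ) : Prop := ∀ k, r k = 1 ∨ r k = -1

lemma IsSign.mul_self {r : ℕ → ℝ} (hr : IsSign r) (k : ℕ) : r k * r k = 1 := by
  rcases hr k with h | h <;> rw [h] <;> norm_num

lemma IsSign.abs_eq {r : ℕ → ℝ} (hr : IsSign r) (k : ℕ) : |r k| = 1 := by
  rcases hr k with h | h <;> rw [h] <;> norm_num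

lemma IsSign.one_add_nonneg {r : ℕ → ℝ} (hr : IsSign r) (k : ℕ) : 0 ≤ 1 + r k := by
  rcases hr k with h | h <;> rw [h] <;> norm_num

lemma IsSign.mul {r s : ℕ → ℝ} (hr : IsSign r) (hs : IsSign s) : IsSign (r * s) := by
  intro k
  rcases hr k with h | h <;> rcases hs k with h' | h' <;> simp [h, h']

lemma signWalsh_eq_prod {n L : ℕ} (h : n < 2 ^ L) (r : ℕ → ℝ) :
    signWalsh n r = ∏ k ∈ Finset.range L, r k ^ binCoeff k n := by
  have key : ∀ {a b : ℕ}, n < 2 ^ a → a ≤ b →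
      ∏ k ∈ Finset.range a, r k ^ binCoeff k n = ∏ k ∈ Finset.range b, r k ^ binCoeff k n := by
    intro a b ha hab
    refine Finset.prod_subset (Finset.range_mono hab) fun k _ hk => ?_
    have : n.testBit k = false := Nat.testBit_lt_two_pow
      (ha.trans_le (Nat.pow_le_pow_right two_pos (by simpa using hk)))
    simp [binCoeff, this]
  rw [signWalsh, key (Nat.lt_pow_succ_log_self one_lt_two n) (le_max_left _ L),
    key h (le_max_right _ _)]

lemma signWalsh_mul (n : ℕ) (r s : ℕ → ℝ) :
    signWalsh n (r * s) = signWalsh n r * signWalsh n s := by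
  simp [signWalsh, mul_pow, Finset.prod_mul_distrib]

@[simp] lemma signWalsh_zero (r : ℕ → ℝ) : signWalsh 0 r = 1 := by
  simp [signWalsh, binCoeff]

lemma signWalsh_xor {r : ℕ → ℝ} (hr : IsSign r) (m n : ℕ) :
    signWalsh (m ^^^ n) r = signWalsh m r * signWalsh n r := by
  obtain ⟨L, hL⟩ : ∃ L, max m n < 2 ^ L := ⟨_, Nat.lt_two_pow_self⟩
  have hm : m < 2 ^ L := (le_max_left _ _).trans_lt hL
  have hn : n < 2 ^ L := (le_max_right _ _).trans_lt hL
  rw [signWalsh_eq_prod (Nat.xor_lt_two_pow hm hn), signWalsh_eq_prod hm, signWalsh_eq_prod hn,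
    ← Finset.prod_mul_distrib]
  refine Finset.prod_congr rfl fun k _ => ?_
  simp only [binCoeff, Nat.testBit_xor]
  have := hr.mul_self k
  cases m.testBit k <;> cases n.testBit k <;> simp [this]

lemma two_pow_mul_add_eq_xor {k q a : ℕ} (h : a < 2 ^ k) : 2 ^ k * q + a = (2 ^ k * q) ^^^ a := by
  refine Nat.eq_of_testBit_eq fun j => ?_
  rw [Nat.testBit_xor, Nat.testBit_two_pow_mul_add _ h, Nat.testBit_two_pow_mul]
  split_ifs with hj
  · simp [not_le.mpr hj]
  · have : a.testBit j = false :=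
      Nat.testBit_lt_two_pow (h.trans_le (Nat.pow_le_pow_right two_pos (not_lt.mp hj)))
    simp [this, not_lt.mp hj]

lemma two_pow_sub_one_sub_eq_xor {k a : ℕ} (h : a < 2 ^ k) :
    2 ^ k - 1 - a = (2 ^ k - 1) ^^^ a := by
  refine Nat.eq_of_testBit_eq fun j => ?_
  rw [Nat.testBit_xor, Nat.testBit_two_pow_sub_one, show 2 ^ k - 1 - a = 2 ^ k - (a + 1) by lia,
    Nat.testBit_two_pow_sub_succ h]
  by_cases hj : j < k
  · simp [hj]
  · have : a.testBit j = false :=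
      Nat.testBit_lt_two_pow (h.trans_le (Nat.pow_le_pow_right two_pos (not_lt.mp hj)))
    simp [this, hj]

section Sign

variable {r : ℕ → ℝ}

lemma IsSign.signWalsh_add (hr : IsSign r) {k a : ℕ} (q : ℕ) (h : a < 2 ^ k) :
    signWalsh (2 ^ k * q + a) r = signWalsh (2 ^ k * q) r * signWalsh a r := by
  rw [two_pow_mul_add_eq_xor h, signWalsh_xor hr]

lemma signWalsh_two_pow (k : ℕ) (r : ℕ → ℝ) : signWalsh (2 ^ k) r = r k := by
  rw [signWalsh_eq_prod (L := k + 1) (Nat.pow_lt_pow_right one_lt_two (Nat.lt_succ_self k)),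
    Finset.prod_eq_single k]
  · simp [binCoeff]
  · intro j _ hj
    simp [binCoeff, Nat.testBit_two_pow_of_ne (Ne.symm hj)]
  · simp

lemma IsSign.signWalsh_eq (hr : IsSign r) (n : ℕ) : signWalsh n r = 1 ∨ signWalsh n r = -1 := by
  have : |signWalsh n r| = 1 := by
    simp [signWalsh, Finset.abs_prod, abs_pow, hr.abs_eq]
  exact eq_or_eq_neg_of_abs_eq this

lemma IsSign.abs_signWalsh (hr : IsSign r) (n : ℕ) : |signWalsh n r| = 1 := by
  rcases hr.signWalsh_eq n with h | h <;> simp [h]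

lemma IsSign.signWalsh_mul_self (hr : IsSign r) (n : ℕ) : signWalsh n r * signWalsh n r = 1 := by
  rcases hr.signWalsh_eq n with h | h <;> simp [h]

@[simp] lemma signDirichlet_zero (r : ℕ → ℝ) : signDirichlet 0 r = 0 := by simp [signDirichlet]

@[simp] lemma signDirichlet_one (r : ℕ → ℝ) : signDirichlet 1 r = 1 := by simp [signDirichlet]

lemma IsSign.signDirichlet_add (hr : IsSign r) {k m : ℕ} (q : ℕ) (h : m ≤ 2 ^ k) :
    signDirichlet (2 ^ k * q + m) r =
      signDirichlet (2 ^ k * q) r + signWalsh (2 ^ k * q) r * signDirichlet m r := by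
  rw [signDirichlet, Finset.sum_range_add, signDirichlet, signDirichlet, Finset.mul_sum]
  congr 1
  exact Finset.sum_congr rfl fun a ha =>
    hr.signWalsh_add q ((Finset.mem_range.mp ha).trans_le h)

lemma IsSign.signDirichlet_two_pow_add (hr : IsSign r) {k m : ℕ} (h : m ≤ 2 ^ k) :
    signDirichlet (2 ^ k + m) r = signDirichlet (2 ^ k) r + r k * signDirichlet m r := by
  have := hr.signDirichlet_add 1 h
  rwa [mul_one, signWalsh_two_pow] at this

lemma IsSign.signDirichlet_two_pow_succ (hr : IsSign r) (k : ℕ) :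
    signDirichlet (2 ^ (k + 1)) r = (1 + r k) * signDirichlet (2 ^ k) r := by
  rw [pow_succ, mul_two, hr.signDirichlet_two_pow_add le_rfl]
  ring

lemma IsSign.signDirichlet_two_pow (hr : IsSign r) (k : ℕ) :
    signDirichlet (2 ^ k) r = ∏ i ∈ Finset.range k, (1 + r i) := by
  induction k with
  | zero => simp
  | succ k ih => rw [hr.signDirichlet_two_pow_succ, ih, Finset.prod_range_succ, mul_comm]

lemma IsSign.signDirichlet_two_pow_nonneg (hr : IsSign r) (k : ℕ) :
    0 ≤ signDirichlet (2 ^ k) r := by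
  rw [hr.signDirichlet_two_pow]
  exact Finset.prod_nonneg fun i _ => hr.one_add_nonneg i

lemma IsSign.signFejer_two_pow_add (hr : IsSign r) {k m : ℕ} (h : m ≤ 2 ^ k) :
    signFejer (2 ^ k + m) r =
      signFejer (2 ^ k) r + m * signDirichlet (2 ^ k) r + r k * signFejer m r := by
  rw [signFejer, Finset.sum_range_add, signFejer, signFejer, Finset.mul_sum, add_assoc]
  congr 1
  rw [Finset.sum_congr rfl fun a ha =>
    hr.signDirichlet_two_pow_add ((Finset.mem_range.mp ha).le.trans h)]
  simp [Finset.sum_add_distrib]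

lemma IsSign.signFejer_two_pow_succ (hr : IsSign r) (k : ℕ) :
    signFejer (2 ^ (k + 1)) r =
      (1 + r k) * signFejer (2 ^ k) r + 2 ^ k * signDirichlet (2 ^ k) r := by
  rw [pow_succ, mul_two, hr.signFejer_two_pow_add le_rfl]
  push_cast
  ring

lemma IsSign.signFejer_two_pow_nonneg (hr : IsSign r) (k : ℕ) : 0 ≤ signFejer (2 ^ k) r := by
  induction k with
  | zero => simp [signFejer]
  | succ k ih =>
    rw [hr.signFejer_two_pow_succ]
    have := hr.one_add_nonneg k
    have := hr.signDirichlet_two_pow_nonneg k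
    positivity

/-- The sequence of signs with the `i`-th sign changed. -/
def flipSign (i : ℕ) (r : ℕ → ℝ) : ℕ → ℝ := Function.update r i (-r i)

lemma IsSign.flip (hr : IsSign r) (i : ℕ) : IsSign (flipSign i r) := by
  intro k
  by_cases h : k = i
  · subst h
    rcases hr k with h | h <;> simp [flipSign, h]
  · simpa [flipSign, Function.update_of_ne h] using hr k

lemma flipSign_self (i : ℕ) (r : ℕ → ℝ) : flipSign i r i = -r i := by simp [flipSign]

lemma flipSign_of_ne {i j : ℕ} (h : j ≠ i) (r : ℕ → ℝ) : flipSign i r j = r j := by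
  simp [flipSign, h]

/-- This makes the Fejér kernel an explicit combination of normalized indicators of dyadic intervals
with at most one digit flipped. The induction uses 1 + r_m + (1 - r_m) = 2 for the new flip. -/
lemma IsSign.signFejer_two_pow (hr : IsSign r) (m : ℕ) :
    signFejer (2 ^ m) r = ∑ i ∈ Finset.range m, 2 ^ i / 2 *
      (signDirichlet (2 ^ m) r + signDirichlet (2 ^ m) (flipSign i r)) := by
  induction m with
  | zero => simp [signFejer]
  | succ m ih =>
    rw [hr.signFejer_two_pow_succ, ih, Finset.sum_range_succ, Finset.mul_sum]
    congr 1
    · refine Finset.sum_congr rfl fun i hi => ?_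
      rw [hr.signDirichlet_two_pow_succ, (hr.flip i).signDirichlet_two_pow_succ,
        flipSign_of_ne (Finset.mem_range.mp hi).ne']
      ring
    · rw [hr.signDirichlet_two_pow_succ, (hr.flip m).signDirichlet_two_pow_succ, flipSign_self]
      have : signDirichlet (2 ^ m) (flipSign m r) = signDirichlet (2 ^ m) r := by
        rw [hr.signDirichlet_two_pow, (hr.flip m).signDirichlet_two_pow]
        refine Finset.prod_congr rfl fun i hi => ?_
        rw [flipSign_of_ne (Finset.mem_range.mp hi).ne]
      rw [this]
      ring

/-- A majorant of all `∑_{k<m} D_k` with `m ≤ 2 ^ l`. -/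
noncomputable def fejerMajorant (l : ℕ) (r : ℕ → ℝ) : ℝ :=
  ∑ i ∈ Finset.range (l + 1), (signFejer (2 ^ i) r + 2 ^ i * signDirichlet (2 ^ i) r)

/-- Removing the leading binary digit of m costs one dyadic Fejér sum and at most 2^i D_{2^i}, and
multiplies the remainder by a sign. -/
lemma IsSign.abs_signFejer_le (hr : IsSign r) {m l : ℕ} (h : m ≤ 2 ^ l) :
    |signFejer m r| ≤ fejerMajorant l r := by
  have hF := hr.signFejer_two_pow_nonneg
  have hD := hr.signDirichlet_two_pow_nonneg
  have main : ∀ l m, m < 2 ^ l → |signFejer m r| ≤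
      ∑ i ∈ Finset.range l, (signFejer (2 ^ i) r + 2 ^ i * signDirichlet (2 ^ i) r) := by
    intro l
    induction l with
    | zero =>
      intro m hm
      have : m = 0 := by simpa using hm
      simp [this, signFejer]
    | succ l ih =>
      intro m hm
      rw [Finset.sum_range_succ]
      rcases lt_or_ge m (2 ^ l) with h | h
      · have := ih m h
        have := hF l
        have := mul_nonneg (pow_nonneg zero_le_two l) (hD l)
        linarith
      · obtain ⟨m, rfl⟩ := Nat.exists_eq_add_of_le h
        have hm' : m < 2 ^ l := by rw [pow_succ] at hm; lia
        rw [hr.signFejer_two_pow_add hm'.le]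
        have h1 := ih m hm'
        have h2 : (m : ℝ) * signDirichlet (2 ^ l) r ≤ 2 ^ l * signDirichlet (2 ^ l) r :=
          mul_le_mul_of_nonneg_right (by exact_mod_cast hm'.le) (hD l)
        have h3 : 0 ≤ (m : ℝ) * signDirichlet (2 ^ l) r := mul_nonneg (by positivity) (hD l)
        have h4 := hF l
        have h5 : |r l * signFejer m r| = |signFejer m r| := by rw [abs_mul, hr.abs_eq, one_mul]
        rw [abs_le] at h1 ⊢
        have h6 := abs_le.mp (h5.le.trans (abs_le.mpr h1))
        constructor <;> linarith [h6.1, h6.2]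
  rw [fejerMajorant, Finset.sum_range_succ]
  rcases h.lt_or_eq with h | rfl
  · have := main l m h
    have := hF l
    have := mul_nonneg (pow_nonneg zero_le_two l) (hD l)
    linarith
  · rw [abs_of_nonneg (hF l)]
    have : 0 ≤ ∑ i ∈ Finset.range l, (signFejer (2 ^ i) r + 2 ^ i * signDirichlet (2 ^ i) r) :=
      Finset.sum_nonneg fun i _ => add_nonneg (hF i) (mul_nonneg (by positivity) (hD i))
    have := mul_nonneg (pow_nonneg zero_le_two l) (hD l)
    linarith

/-! ### Dirichlet kernels dominated through the variation of the binary digits -/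

lemma binCoeff_le_one (k n : ℕ) : binCoeff k n ≤ 1 := by
  unfold binCoeff; cases n.testBit k <;> simp

lemma binCoeff_eq_zero_of_lt {k n : ℕ} (h : n < 2 ^ k) : binCoeff k n = 0 := by
  simp [binCoeff, Nat.testBit_lt_two_pow h]

lemma div_two_pow_eq (k n : ℕ) : n / 2 ^ k = 2 * (n / 2 ^ (k + 1)) + binCoeff k n := by
  have h : binCoeff k n = n / 2 ^ k % 2 := by
    rw [binCoeff, Nat.testBit_eq_decide_div_mod_eq]
    rcases Nat.mod_two_eq_zero_or_one (n / 2 ^ k) with h | h <;> simp [h]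
  rw [h, pow_succ, ← Nat.div_div_eq_div_mul]
  lia

/-- D_{2^k} vanishes unless the first k signs are 1, and there w_a = 1. -/
lemma IsSign.signWalsh_mul_signDirichlet_two_pow (hr : IsSign r) {a k : ℕ} (h : a < 2 ^ k) :
    signWalsh a r * signDirichlet (2 ^ k) r = signDirichlet (2 ^ k) r := by
  by_cases hk : ∀ i < k, r i = 1
  · rw [signWalsh_eq_prod h, Finset.prod_eq_one, one_mul]
    intro i hi
    rw [hk i (Finset.mem_range.mp hi), one_pow]
  · push Not at hk
    obtain ⟨i, hi, hne⟩ := hk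
    rw [hr.signDirichlet_two_pow, Finset.prod_eq_zero (Finset.mem_range.mpr hi), mul_zero]
    rw [(hr i).resolve_left hne]
    norm_num

/-- Passing from l to l+1 deletes the digit ε_l and turns ε_l D_{2^l} into ε_l D_{2^{l+1}}.
Replacing ε_l by ε_{l+1} then costs one digit jump. The correction term ε_l D_{2^l} is what makes
jumps appear instead of digits. -/
lemma IsSign.abs_signWalsh_mul_signDirichlet_add_le (hr : IsSign r) (n l : ℕ) :
    |signWalsh n r * signDirichlet (2 ^ l * (n / 2 ^ l)) r
        + binCoeff l n * signDirichlet (2 ^ l) r| ≤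
      ∑ k ∈ Finset.Ico l (Nat.log 2 n + 1),
        |(binCoeff k n : ℝ) - binCoeff (k + 1) n| * signDirichlet (2 ^ (k + 1)) r := by
  obtain ⟨d, hd⟩ : ∃ d, Nat.log 2 n + 1 - l ≤ d := ⟨_, le_rfl⟩
  induction d generalizing l with
  | zero =>
    have hl : n < 2 ^ l := (Nat.lt_pow_succ_log_self one_lt_two n).trans_le
      (Nat.pow_le_pow_right two_pos (by lia))
    rw [Nat.div_eq_of_lt hl, binCoeff_eq_zero_of_lt hl, Finset.Ico_eq_empty_of_le (by lia)]
    simp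
  | succ d ih =>
    rcases Nat.lt_or_ge l (Nat.log 2 n + 1) with hl | hl
    swap
    · exact ih l (by lia)
    rw [Finset.sum_eq_sum_Ico_succ_bot hl]
    set q := n / 2 ^ (l + 1) with hq
    have hb : 2 ^ l * (n / 2 ^ l) = 2 ^ (l + 1) * q + 2 ^ l * binCoeff l n := by
      rw [div_two_pow_eq, ← hq]; ring
    have hle : 2 ^ l * binCoeff l n < 2 ^ (l + 1) := by
      have := binCoeff_le_one l n
      calc 2 ^ l * binCoeff l n ≤ 2 ^ l * 1 := Nat.mul_le_mul_left _ this
        _ < 2 ^ (l + 1) := by rw [mul_one]; exact Nat.pow_lt_pow_right one_lt_two (by lia)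
    have hn : signWalsh n r * signDirichlet (2 ^ l) r =
        signWalsh (2 ^ l * (n / 2 ^ l)) r * signDirichlet (2 ^ l) r := by
      conv_lhs => rw [← Nat.div_add_mod n (2 ^ l)]
      rw [hr.signWalsh_add _ (Nat.mod_lt _ (by positivity)), mul_assoc,
        hr.signWalsh_mul_signDirichlet_two_pow (Nat.mod_lt _ (by positivity))]
    -- When ε_l = 1, the piece of D split off contributes r_l D_{2^l} after multiplication by w_n,
    -- and (1 + r_l) D_{2^l} = D_{2^{l+1}}.
    have key : signWalsh n r * signDirichlet (2 ^ l * (n / 2 ^ l)) r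
        + binCoeff l n * signDirichlet (2 ^ l) r =
        signWalsh n r * signDirichlet (2 ^ (l + 1) * q) r
        + binCoeff l n * signDirichlet (2 ^ (l + 1)) r := by
      rw [hb, hr.signDirichlet_add q hle.le]
      rw [hb, hr.signWalsh_add q hle] at hn
      have h2 := hr.signWalsh_mul_self (2 ^ (l + 1) * q)
      rw [hr.signDirichlet_two_pow_succ]
      rcases Nat.le_one_iff_eq_zero_or_eq_one.mp (binCoeff_le_one l n) with h | h
      · simp [h]
      · rw [h, mul_one, signWalsh_two_pow] at hn
        rw [h, mul_one]
        push_cast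
        linear_combination signWalsh (2 ^ (l + 1) * q) r * hn + r l * signDirichlet (2 ^ l) r * h2
    rw [key]
    have h3 : signWalsh n r * signDirichlet (2 ^ (l + 1) * q) r
        + binCoeff l n * signDirichlet (2 ^ (l + 1)) r =
        ((binCoeff l n : ℝ) - binCoeff (l + 1) n) * signDirichlet (2 ^ (l + 1)) r +
        (signWalsh n r * signDirichlet (2 ^ (l + 1) * q) r
        + binCoeff (l + 1) n * signDirichlet (2 ^ (l + 1)) r) := by ring
    rw [h3]
    refine (abs_add_le _ _).trans (add_le_add ?_ (ih (l + 1) (by lia)))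
    rw [abs_mul, abs_of_nonneg (hr.signDirichlet_two_pow_nonneg _)]

lemma IsSign.abs_signDirichlet_le (hr : IsSign r) (n l : ℕ) :
    |signDirichlet (2 ^ l * (n / 2 ^ l)) r| ≤ signDirichlet (2 ^ l) r +
      ∑ k ∈ Finset.Ico l (Nat.log 2 n + 1),
        |(binCoeff k n : ℝ) - binCoeff (k + 1) n| * signDirichlet (2 ^ (k + 1)) r := by
  have h1 := hr.abs_signWalsh_mul_signDirichlet_add_le n l
  have h2 : |signDirichlet (2 ^ l * (n / 2 ^ l)) r| =
      |signWalsh n r * signDirichlet (2 ^ l * (n / 2 ^ l)) r| := by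
    rw [abs_mul, hr.abs_signWalsh, one_mul]
  have hD := hr.signDirichlet_two_pow_nonneg l
  have h3 : (binCoeff l n : ℝ) * signDirichlet (2 ^ l) r ≤ signDirichlet (2 ^ l) r :=
    mul_le_of_le_one_left hD (by exact_mod_cast binCoeff_le_one l n)
  have h4 : 0 ≤ (binCoeff l n : ℝ) * signDirichlet (2 ^ l) r := by positivity
  rw [h2, abs_le]
  rw [abs_le] at h1
  constructor <;> linarith [h1.1, h1.2]

/-- Below a multiple b of 2^l the Walsh functions run backwards: complementing the low bits is an
xor, so w_{b-1-m} = w_{b-1} w_m. -/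
lemma IsSign.signDirichlet_sub (hr : IsSign r) {l m : ℕ} (q : ℕ) (h : m ≤ 2 ^ l) :
    signDirichlet (2 ^ l * (q + 1) - m) r = signDirichlet (2 ^ l * (q + 1)) r -
      signWalsh (2 ^ l * (q + 1) - 1) r * signDirichlet m r := by
  have hpos : 0 < 2 ^ l := by positivity
  induction m with
  | zero => simp
  | succ m ih =>
    have hm : m < 2 ^ l := h
    have e0 : 2 ^ l * (q + 1) = 2 ^ l * q + 2 ^ l := by ring
    have e1 : 2 ^ l * (q + 1) - m = (2 ^ l * (q + 1) - (m + 1)) + 1 := by lia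
    have e2 : 2 ^ l * (q + 1) - (m + 1) = 2 ^ l * q + (2 ^ l - 1 - m) := by lia
    have e3 : 2 ^ l * (q + 1) - 1 = 2 ^ l * q + (2 ^ l - 1) := by lia
    have h1 := ih hm.le
    rw [e1, signDirichlet, Finset.sum_range_succ, ← signDirichlet] at h1
    have h2 : signWalsh (2 ^ l * (q + 1) - (m + 1)) r =
        signWalsh (2 ^ l * (q + 1) - 1) r * signWalsh m r := by
      rw [e2, e3, hr.signWalsh_add q (by lia), hr.signWalsh_add q (by lia),
        two_pow_sub_one_sub_eq_xor hm, signWalsh_xor hr, mul_assoc]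
    rw [signDirichlet.eq_1 (m + 1), Finset.sum_range_succ, ← signDirichlet]
    linear_combination h1 - h2

/-- The indices n-i lie within 2^l of the multiple b of 2^l, on one side or the other. Each side
contributes copies of D_b and a Fejér sum times a sign, whence the factor 2. -/
lemma IsSign.abs_sum_signDirichlet_sub_le (hr : IsSign r) {n l L : ℕ} (hL : L ≤ 2 ^ l)
    (hn : L ≤ n + 1) :
    |∑ i ∈ Finset.range L, signDirichlet (n - i) r| ≤
      L * |signDirichlet (2 ^ l * (n / 2 ^ l)) r| + 2 * fejerMajorant l r := by
  set b := 2 ^ l * (n / 2 ^ l) with hb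
  set R := n % 2 ^ l with hR
  have hnb : n = b + R := (Nat.div_add_mod n (2 ^ l)).symm
  have hRl : R < 2 ^ l := Nat.mod_lt _ (by positivity)
  -- Indices n-i ≥ b: here D_{n-i} = D_b + w_b D_{R-i}.
  have low : ∀ L, L ≤ R + 1 → ∑ i ∈ Finset.range L, signDirichlet (n - i) r =
      L * signDirichlet b r +
        signWalsh b r * (signFejer (R + 1) r - signFejer (R + 1 - L) r) := by
    intro L hL
    induction L with
    | zero => simp
    | succ L ih =>
      rw [Finset.sum_range_succ, ih (by lia), show n - L = b + (R - L) by lia,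
        hr.signDirichlet_add _ (by lia), show R + 1 - L = (R - L) + 1 by lia,
        show R + 1 - (L + 1) = R - L by lia, signFejer.eq_1 (R - L + 1), Finset.sum_range_succ,
        ← signFejer]
      push_cast
      ring
  -- The d further indices b-1, ..., b-d lie below b and produce D_1, ..., D_d, which add up to
  -- F_{d+1}.
  have high : ∀ d, R + 1 + d ≤ n + 1 → R + 1 + d ≤ 2 ^ l →
      ∑ i ∈ Finset.range (R + 1 + d), signDirichlet (n - i) r =
      ((R + 1 + d : ℕ) : ℝ) * signDirichlet b r + signWalsh b r * signFejer (R + 1) r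
        - signWalsh (b - 1) r * signFejer (d + 1) r := by
    intro d hd hd'
    induction d with
    | zero =>
      rw [add_zero, low _ le_rfl]
      simp [signFejer]
    | succ d ih =>
      have hbpos : 0 < n / 2 ^ l := by
        by_contra h
        rw [show n / 2 ^ l = 0 by lia, mul_zero] at hb
        lia
      obtain ⟨q, hq⟩ := Nat.exists_eq_add_one.mpr hbpos
      have h1 := hr.signDirichlet_sub (l := l) (m := d + 1) q (by lia)
      rw [← hq, ← hb] at h1
      rw [← add_assoc, Finset.sum_range_succ, ih (by lia) (by lia),
        show n - (R + 1 + d) = b - (d + 1) by lia, h1, signFejer.eq_1 (d + 1 + 1),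
        Finset.sum_range_succ, ← signFejer]
      push_cast
      ring
  have bound : ∀ x y z w : ℝ, |w| = 1 → ∀ v : ℝ, |v| = 1 → |y| ≤ fejerMajorant l r →
      |z| ≤ fejerMajorant l r →
      |L * x + w * y - v * z| ≤ L * |x| + 2 * fejerMajorant l r := by
    intro x y z w hw v hv hy hz
    calc |L * x + w * y - v * z| ≤ |L * x| + |w * y| + |v * z| :=
          (abs_sub _ _).trans (add_le_add (abs_add_le _ _) le_rfl)
      _ = L * |x| + |y| + |z| := by rw [abs_mul, abs_mul, abs_mul, hw, hv, Nat.abs_cast]; ring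
      _ ≤ _ := by linarith
  rcases Nat.le_total L (R + 1) with h | h
  · rw [low L h, mul_sub, ← add_sub_assoc]
    exact bound _ _ _ _ (hr.abs_signWalsh _) _ (hr.abs_signWalsh _)
      (hr.abs_signFejer_le (by lia)) (hr.abs_signFejer_le (by lia))
  · obtain ⟨d, rfl⟩ := Nat.exists_eq_add_of_le h
    rw [high d hn hL]
    exact bound _ _ _ _ (hr.abs_signWalsh _) _ (hr.abs_signWalsh _)
      (hr.abs_signFejer_le (by lia)) (hr.abs_signFejer_le (by lia))

/-! ### Abel summation and the pointwise bound for the kernel -/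

/-- The kernel `V_n` as a function of the Rademacher signs. -/
noncomputable def signKernelV (t : ℕ → ℕ → ℝ) (n : ℕ) (r : ℕ → ℝ) : ℝ :=
  ∑ l ∈ Finset.range (n + 1), t l n * signDirichlet (n - l) r

/-- The differences `a_j - a_{j+1}` for `j < n`, followed by `a_n`. -/
def truncDiff (a : ℕ → ℝ) (n j : ℕ) : ℝ := if j = n then a n else a j - a (j + 1)

lemma truncDiff_nonneg {a : ℕ → ℝ} (h0 : ∀ k, 0 ≤ a k) (h1 : ∀ k, a (k + 1) ≤ a k) (n j : ℕ) :
    0 ≤ truncDiff a n j := by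
  unfold truncDiff
  split_ifs
  · exact h0 n
  · exact sub_nonneg.mpr (h1 j)

lemma sum_mul_eq_sum_truncDiff (a d : ℕ → ℝ) (n : ℕ) :
    ∑ l ∈ Finset.range (n + 1), a l * d l =
      ∑ j ∈ Finset.range (n + 1), truncDiff a n j * ∑ l ∈ Finset.range (j + 1), d l := by
  have key : ∀ n, ∑ l ∈ Finset.range (n + 1), a l * d l =
      ∑ j ∈ Finset.range n, (a j - a (j + 1)) * ∑ l ∈ Finset.range (j + 1), d l +
        a n * ∑ l ∈ Finset.range (n + 1), d l := by
    intro n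
    induction n with
    | zero => simp
    | succ n ih =>
      rw [Finset.sum_range_succ, ih, Finset.sum_range_succ (fun j => (a j - a (j + 1)) *
        ∑ l ∈ Finset.range (j + 1), d l) n, Finset.sum_range_succ d (n + 1)]
      ring
  rw [key, Finset.sum_range_succ (fun j => truncDiff a n j * ∑ l ∈ Finset.range (j + 1), d l) n]
  congr 1
  · refine Finset.sum_congr rfl fun j hj => ?_
    rw [truncDiff, if_neg (Finset.mem_range.mp hj).ne]
  · rw [truncDiff, if_pos rfl]

/-- Abel summation against the indicator of l ≤ J, whose partial sums are j+1 for j ≤ J. -/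
lemma sum_truncDiff_mul_le {a : ℕ → ℝ} (h0 : ∀ k, 0 ≤ a k) (h1 : ∀ k, a (k + 1) ≤ a k)
    (n J : ℕ) :
    ∑ j ∈ (Finset.range (n + 1)).filter (· ≤ J), truncDiff a n j * (j + 1) ≤
      ∑ l ∈ Finset.range (J + 1), a l := by
  have h := sum_mul_eq_sum_truncDiff a (fun l => if l ≤ J then 1 else 0) n
  calc ∑ j ∈ (Finset.range (n + 1)).filter (· ≤ J), truncDiff a n j * (j + 1)
      ≤ ∑ j ∈ Finset.range (n + 1), truncDiff a n j *
          ∑ l ∈ Finset.range (j + 1), (if l ≤ J then 1 else 0 : ℝ) := by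
        rw [Finset.sum_filter]
        refine Finset.sum_le_sum fun j _ => ?_
        split_ifs with hj
        · refine mul_le_mul_of_nonneg_left ?_ (truncDiff_nonneg h0 h1 n j)
          rw [Finset.sum_congr rfl fun l hl => if_pos ((Finset.mem_range_succ_iff.mp hl).trans hj)]
          simp
        · exact mul_nonneg (truncDiff_nonneg h0 h1 n j)
            (Finset.sum_nonneg fun l _ => by split_ifs <;> norm_num)
    _ = ∑ l ∈ (Finset.range (n + 1)).filter (· ≤ J), a l := by
        rw [← h, Finset.sum_filter]
        exact Finset.sum_congr rfl fun l _ => by split_ifs <;> simp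
    _ ≤ _ := by
        refine Finset.sum_le_sum_of_subset_of_nonneg (fun l hl => ?_) fun l _ _ => h0 l
        simp only [Finset.mem_filter] at hl
        exact Finset.mem_range_succ_iff.mpr hl.2

lemma IsSign.abs_signKernelV_le (hr : IsSign r) {t : ℕ → ℕ → ℝ} (ht : IsTransformationMatrix t)
    (n : ℕ) :
    |signKernelV t n r| ≤ ∑ j ∈ Finset.range (n + 1), truncDiff (t · n) n j *
      ((j + 1 : ℝ) * (signDirichlet (2 ^ Nat.clog 2 (j + 1)) r +
        ∑ k ∈ Finset.Ico (Nat.clog 2 (j + 1)) (Nat.log 2 n + 1),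
          |(binCoeff k n : ℝ) - binCoeff (k + 1) n| * signDirichlet (2 ^ (k + 1)) r) +
      2 * fejerMajorant (Nat.clog 2 (j + 1)) r) := by
  rw [signKernelV, sum_mul_eq_sum_truncDiff (t · n)]
  refine (Finset.abs_sum_le_sum_abs _ _).trans (Finset.sum_le_sum fun j hj => ?_)
  have hs := truncDiff_nonneg (a := (t · n)) (ht.nonneg · n) (ht.antitone · n) n j
  rw [abs_mul, abs_of_nonneg hs]
  refine mul_le_mul_of_nonneg_left ?_ hs
  refine (hr.abs_sum_signDirichlet_sub_le (Nat.le_pow_clog one_lt_two (j + 1))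
    (Finset.mem_range.mp hj)).trans ?_
  push_cast
  gcongr
  exact hr.abs_signDirichlet_le n _

/-- The left side is the bound of `IsSign.abs_signKernelV_le` with D_{2^m} replaced by 1 and F_{2^m}
by 2^m, the constants with which their means are controlled later. In 17 = 1 + 16, the 1 comes from
D_{2^l} and the 16 from the Fejér sums, since 2^l ≤ 2(j+1) for l = `Nat.clog 2 (j + 1)`. -/
lemma sum_truncDiff_bound_le {t : ℕ → ℕ → ℝ} (ht : IsTransformationMatrix t) (n : ℕ) :
    ∑ j ∈ Finset.range (n + 1), truncDiff (t · n) n j *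
      ((j + 1 : ℝ) * (1 + ∑ k ∈ Finset.Ico (Nat.clog 2 (j + 1)) (Nat.log 2 n + 1),
          |(binCoeff k n : ℝ) - binCoeff (k + 1) n| * 1) +
      2 * ∑ i ∈ Finset.range (Nat.clog 2 (j + 1) + 1), (2 ^ i + 2 ^ i * 1)) ≤
    17 + upsilon t n := by
  have h0 := (ht.nonneg · n)
  have h1 := (ht.antitone · n)
  have hs := truncDiff_nonneg h0 h1 n
  have hone : ∑ j ∈ Finset.range (n + 1), truncDiff (t · n) n j * (j + 1 : ℝ) = 1 := by
    have := sum_mul_eq_sum_truncDiff (t · n) (fun _ => 1) n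
    simp only [mul_one, ht.sum_eq_one, Finset.sum_const, Finset.card_range, nsmul_eq_mul] at this
    refine Eq.trans ?_ this.symm
    exact Finset.sum_congr rfl fun j _ => by rw [Nat.cast_add_one]
  have hgeo : ∀ j : ℕ, 2 * ∑ i ∈ Finset.range (Nat.clog 2 (j + 1) + 1), ((2 : ℝ) ^ i + 2 ^ i * 1) ≤
      16 * (j + 1) := by
    intro j
    have e : ∑ i ∈ Finset.range (Nat.clog 2 (j + 1) + 1), ((2 : ℝ) ^ i + 2 ^ i * 1) =
        2 * (2 ^ (Nat.clog 2 (j + 1) + 1) - 1) := by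
      have := geom_sum_eq (by norm_num : (2 : ℝ) ≠ 1) (Nat.clog 2 (j + 1) + 1)
      rw [show (2 : ℝ) - 1 = 1 by norm_num, div_one] at this
      rw [← this, Finset.mul_sum]
      exact Finset.sum_congr rfl fun i _ => by ring
    have hlt : 2 ^ Nat.clog 2 (j + 1) ≤ 2 * (j + 1) := by
      rcases Nat.eq_zero_or_pos j with rfl | hj
      · simp
      · have h2 := Nat.pow_pred_clog_lt_self one_lt_two (x := j + 1) (by lia)
        have h3 : 0 < Nat.clog 2 (j + 1) := Nat.clog_pos one_lt_two (by lia)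
        obtain ⟨c, hc⟩ := Nat.exists_eq_add_one.mpr h3
        rw [hc] at h2 ⊢
        rw [Nat.pred_succ] at h2
        rw [pow_succ]
        lia
    have hlt' : (2 : ℝ) ^ Nat.clog 2 (j + 1) ≤ 2 * (j + 1) := by exact_mod_cast hlt
    rw [e, pow_succ]
    linarith
  -- After interchanging sums, the jump at k is weighted by the j with j+1 ≤ 2^k, whose total weight
  -- is at most τ_{2^k,n}.
  have hvar : ∑ j ∈ Finset.range (n + 1), truncDiff (t · n) n j * (j + 1 : ℝ) *
      ∑ k ∈ Finset.Ico (Nat.clog 2 (j + 1)) (Nat.log 2 n + 1),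
        |(binCoeff k n : ℝ) - binCoeff (k + 1) n| ≤ upsilon t n := by
    calc _ = ∑ j ∈ Finset.range (n + 1), ∑ k ∈ Finset.range (Nat.log 2 n + 1),
          if Nat.clog 2 (j + 1) ≤ k then |(binCoeff k n : ℝ) - binCoeff (k + 1) n| *
            (truncDiff (t · n) n j * (j + 1 : ℝ)) else 0 := by
          refine Finset.sum_congr rfl fun j _ => ?_
          rw [← Finset.sum_filter, Finset.mul_sum]
          refine Finset.sum_congr ?_ fun k _ => mul_comm _ _
          ext k
          simp [and_comm]
      _ = ∑ k ∈ Finset.range (Nat.log 2 n + 1), |(binCoeff k n : ℝ) - binCoeff (k + 1) n| *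
          ∑ j ∈ (Finset.range (n + 1)).filter (fun j => Nat.clog 2 (j + 1) ≤ k),
            truncDiff (t · n) n j * (j + 1 : ℝ) := by
          rw [Finset.sum_comm]
          refine Finset.sum_congr rfl fun k _ => ?_
          rw [← Finset.sum_filter, Finset.mul_sum]
      _ ≤ upsilon t n := by
          refine Finset.sum_le_sum fun k _ => mul_le_mul_of_nonneg_left ?_ (abs_nonneg _)
          refine le_trans ?_ (sum_truncDiff_mul_le h0 h1 n (2 ^ k))
          refine Finset.sum_le_sum_of_subset_of_nonneg (fun j hj => ?_) fun j _ _ =>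
            mul_nonneg (hs j) (by positivity)
          simp only [Finset.mem_filter] at hj ⊢
          refine ⟨hj.1, ?_⟩
          have := (Nat.clog_le_iff_le_pow one_lt_two).mp hj.2
          lia
  calc _ ≤ ∑ j ∈ Finset.range (n + 1), (17 * (truncDiff (t · n) n j * (j + 1 : ℝ)) +
        truncDiff (t · n) n j * (j + 1 : ℝ) *
      ∑ k ∈ Finset.Ico (Nat.clog 2 (j + 1)) (Nat.log 2 n + 1),
        |(binCoeff k n : ℝ) - binCoeff (k + 1) n|) := by
        refine Finset.sum_le_sum fun j _ => ?_
        have := mul_le_mul_of_nonneg_left (hgeo j) (hs j)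
        simp only [mul_one] at this ⊢
        linarith
    _ ≤ _ := by
        rw [Finset.sum_add_distrib, ← Finset.mul_sum, hone]
        linarith

end Sign

/-! ### Rademacher signs of real numbers and orthogonality of the Walsh functions -/

/-- The sequence of the values of the Rademacher functions at `x`. -/
noncomputable def radSeq (x : ℝ) : ℕ → ℝ := fun k => rademacher k x

lemma digit_eq (x : ℝ) (k : ℕ) : digit x k = ⌊x * 2 ^ (k + 1)⌋₊ % 2 := by
  simp [digit, Real.digits]

lemma digit_lt_two (x : ℝ) (k : ℕ) : digit x k < 2 := by
  rw [digit_eq]; exact Nat.mod_lt _ two_pos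

lemma isSign_radSeq (x : ℝ) : IsSign (radSeq x) := fun _ => neg_one_pow_eq_or ℝ _

lemma walsh_eq (n : ℕ) (x : ℝ) : walsh n x = signWalsh n (radSeq x) := rfl

lemma dirichletKernel_eq (n : ℕ) (x : ℝ) :
    dirichletKernel n x = signDirichlet n (radSeq x) := rfl

lemma kernelV_eq (t : ℕ → ℕ → ℝ) (n : ℕ) (x : ℝ) :
    kernelV t n x = signKernelV t n (radSeq x) := by
  rw [signKernelV, ← Finset.sum_range_reflect, Finset.sum_range_succ', kernelV]
  simp only [dirichletKernel_eq]
  rw [← Finset.Ico_add_one_right_eq_Icc, Finset.sum_Ico_eq_sum_range]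
  simp only [add_tsub_cancel_right, tsub_zero, tsub_self, signDirichlet_zero, mul_zero, add_zero]
  refine Finset.sum_congr rfl fun k hk => ?_
  rw [Finset.mem_range] at hk
  rw [add_comm 1 k, show n - (n - (k + 1)) = k + 1 by lia]

lemma measurable_radSeq : Measurable radSeq := by
  refine measurable_pi_lambda _ fun k => ?_
  have : (fun x => radSeq x k) = (fun m : ℕ => (-1 : ℝ) ^ (m % 2)) ∘ fun x => ⌊x * 2 ^ (k + 1)⌋₊ := by
    funext x
    simp [radSeq, rademacher, digit_eq]
  rw [this]
  exact Measurable.of_discrete.comp (Nat.measurable_floor.comp (measurable_id.mul_const _))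

lemma measurable_signWalsh (n : ℕ) : Measurable (signWalsh n) := by
  unfold signWalsh
  fun_prop

lemma measurable_signDirichlet (n : ℕ) : Measurable (signDirichlet n) := by
  unfold signDirichlet
  exact Finset.measurable_fun_sum _ fun k _ => measurable_signWalsh k

lemma measurable_signFejer (n : ℕ) : Measurable (signFejer n) := by
  unfold signFejer
  exact Finset.measurable_fun_sum _ fun k _ => measurable_signDirichlet k

lemma measurable_flipSign (i : ℕ) : Measurable (flipSign i) := by
  refine measurable_pi_lambda _ fun k => ?_
  by_cases h : k = i
  · subst h
    simp only [flipSign_self]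
    fun_prop
  · simp only [flipSign_of_ne h]
    fun_prop

instance : IsProbabilityMeasure unitMeasure := ⟨by simp [unitMeasure]⟩

lemma rademacher_add_one {x : ℝ} (hx : 0 ≤ x) (k : ℕ) :
    rademacher k (x + 1) = rademacher k x := by
  have : ⌊(x + 1) * 2 ^ (k + 1)⌋₊ = ⌊x * 2 ^ (k + 1)⌋₊ + 2 * 2 ^ k := by
    rw [← Nat.floor_add_natCast (by positivity)]
    congr 1
    push_cast
    ring
  rw [rademacher, rademacher, digit_eq, digit_eq, this, Nat.add_mul_mod_self_left]

lemma rademacher_add_two_pow_inv_self {x : ℝ} (hx : 0 ≤ x) (k : ℕ) :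
    rademacher k (x + (2 ^ (k + 1))⁻¹) = -rademacher k x := by
  have : ⌊(x + (2 ^ (k + 1))⁻¹) * 2 ^ (k + 1)⌋₊ = ⌊x * 2 ^ (k + 1)⌋₊ + 1 := by
    rw [← Nat.floor_add_one (by positivity), add_mul, inv_mul_cancel₀ (by positivity)]
  rw [rademacher, rademacher, digit_eq, digit_eq, this]
  rcases Nat.mod_two_eq_zero_or_one ⌊x * 2 ^ (k + 1)⌋₊ with h | h
  · rw [show (⌊x * 2 ^ (k + 1)⌋₊ + 1) % 2 = 1 by lia, h]; norm_num
  · rw [show (⌊x * 2 ^ (k + 1)⌋₊ + 1) % 2 = 0 by lia, h]; norm_num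

lemma rademacher_add_two_pow_inv_of_lt {x : ℝ} (hx : 0 ≤ x) {k j : ℕ} (h : k < j) :
    rademacher j (x + (2 ^ (k + 1))⁻¹) = rademacher j x := by
  obtain ⟨d, rfl⟩ := Nat.exists_eq_add_of_lt h
  have : ⌊(x + (2 ^ (k + 1))⁻¹) * 2 ^ (k + d + 1 + 1)⌋₊ =
      ⌊x * 2 ^ (k + d + 1 + 1)⌋₊ + 2 * 2 ^ d := by
    rw [← Nat.floor_add_natCast (by positivity)]
    congr 1
    push_cast
    field_simp
    ring
  rw [rademacher, rademacher, digit_eq, digit_eq, this, Nat.add_mul_mod_self_left]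

lemma walsh_add_one {x : ℝ} (hx : 0 ≤ x) (n : ℕ) : walsh n (x + 1) = walsh n x := by
  simp [walsh, rademacher_add_one hx]

/-- Take k to be the lowest set bit of n. Adding 2^{-(k+1)} flips the k-th digit and carries only
into digits of index below k, on which w_n does not depend. -/
lemma exists_walsh_add_eq_neg {n : ℕ} (hn : n ≠ 0) :
    ∃ k : ℕ, ∀ x : ℝ, 0 ≤ x → walsh n (x + (2 ^ (k + 1))⁻¹) = -walsh n x := by
  have hex := Nat.exists_testBit_of_ne_zero hn
  classical
  set k := Nat.find hex with hk
  have hkb : n.testBit k = true := Nat.find_spec hex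
  have hmin : ∀ j < k, n.testBit j = false := fun j hj => by
    simpa using Nat.find_min hex hj
  refine ⟨k, fun x hx => ?_⟩
  have hlt : k < Nat.log 2 n + 1 := by
    by_contra h
    have := Nat.testBit_lt_two_pow ((Nat.lt_pow_succ_log_self one_lt_two n).trans_le
      (Nat.pow_le_pow_right two_pos (not_lt.mp h)))
    rw [this] at hkb
    exact Bool.false_ne_true hkb
  rw [walsh, walsh, ← Finset.mul_prod_erase _ _ (Finset.mem_range.mpr hlt),
    ← Finset.mul_prod_erase _ (fun k => rademacher k x ^ binCoeff k n) (Finset.mem_range.mpr hlt),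
    rademacher_add_two_pow_inv_self hx, ← neg_mul]
  congr 1
  · simp [binCoeff, hkb]
  · refine Finset.prod_congr rfl fun j hj => ?_
    rcases lt_or_gt_of_ne (Finset.ne_of_mem_erase hj) with h | h
    · simp [binCoeff, hmin j h]
    · rw [rademacher_add_two_pow_inv_of_lt hx h]

lemma abs_walsh (n : ℕ) (x : ℝ) : |walsh n x| = 1 := (isSign_radSeq x).abs_signWalsh n

lemma measurable_walsh (n : ℕ) : Measurable (walsh n) :=
  (measurable_signWalsh n).comp measurable_radSeq

lemma integrable_walsh (n : ℕ) : Integrable (walsh n) unitMeasure :=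
  Integrable.of_bound (measurable_walsh n).aestronglyMeasurable 1
    (Filter.Eventually.of_forall fun x => (abs_walsh n x).le)

lemma intervalIntegrable_walsh (n : ℕ) (a b : ℝ) :
    IntervalIntegrable (walsh n) volume a b := by
  rw [intervalIntegrable_iff]
  exact IntegrableOn.of_bound (by simp) (measurable_walsh n).aestronglyMeasurable 1
    (Filter.Eventually.of_forall fun x => (abs_walsh n x).le)

lemma integral_walsh_of_ne_zero {n : ℕ} (hn : n ≠ 0) : ∫ x, walsh n x ∂unitMeasure = 0 := by
  obtain ⟨k, hk⟩ := exists_walsh_add_eq_neg hn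
  set e : ℝ := (2 ^ (k + 1))⁻¹ with he
  have he0 : 0 ≤ e := by positivity
  have hI : ∫ x, walsh n x ∂unitMeasure = ∫ x in (0 : ℝ)..1, walsh n x := by
    rw [unitMeasure, integral_Ico_eq_integral_Ioc, intervalIntegral.integral_of_le zero_le_one]
  rw [hI]
  have h1 : ∫ x in (0 : ℝ)..1, walsh n x = -∫ x in e..(1 + e), walsh n x := by
    have := intervalIntegral.integral_comp_add_right (a := 0) (b := 1) (walsh n) e
    rw [zero_add] at this
    rw [← this, ← intervalIntegral.integral_neg]
    refine intervalIntegral.integral_congr fun x hx => ?_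
    rw [Set.uIcc_of_le zero_le_one] at hx
    simp [hk x hx.1]
  have h2 : ∫ x in (1 : ℝ)..(1 + e), walsh n x = ∫ x in (0 : ℝ)..e, walsh n x := by
    have := intervalIntegral.integral_comp_add_right (a := 0) (b := e) (walsh n) 1
    rw [zero_add, add_comm e 1] at this
    rw [← this]
    refine intervalIntegral.integral_congr fun x hx => ?_
    rw [Set.uIcc_of_le he0] at hx
    exact walsh_add_one hx.1 n
  have h3 := intervalIntegral.integral_add_adjacent_intervals
    (intervalIntegrable_walsh n e 1) (intervalIntegrable_walsh n 1 (1 + e))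
  have h4 := intervalIntegral.integral_add_adjacent_intervals
    (intervalIntegrable_walsh n 0 e) (intervalIntegrable_walsh n e 1)
  linarith

lemma walsh_mul_walsh (m n : ℕ) (x : ℝ) : walsh m x * walsh n x = walsh (m ^^^ n) x :=
  (signWalsh_xor (isSign_radSeq x) m n).symm

lemma walsh_zero (x : ℝ) : walsh 0 x = 1 := signWalsh_zero _

lemma integral_walsh_mul_walsh (m n : ℕ) :
    ∫ x, walsh m x * walsh n x ∂unitMeasure = if m = n then 1 else 0 := by
  simp only [walsh_mul_walsh]
  split_ifs with h
  · simp [h, walsh_zero]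
  · exact integral_walsh_of_ne_zero (Nat.xor_ne_zero_iff.mpr h)

lemma lintegral_signDirichlet_two_pow {s : ℕ → ℝ} (hs : IsSign s) (m : ℕ) :
    ∫⁻ x, ENNReal.ofReal (signDirichlet (2 ^ m) (s * radSeq x)) ∂unitMeasure = 1 := by
  have hint : ∀ k, Integrable (fun x => signWalsh k s * walsh k x) unitMeasure := fun k =>
    (integrable_walsh k).const_mul _
  have heq : ∀ x, signDirichlet (2 ^ m) (s * radSeq x) =
      ∑ k ∈ Finset.range (2 ^ m), signWalsh k s * walsh k x := fun x => by
    simp only [signDirichlet, signWalsh_mul, walsh_eq]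
  rw [← ofReal_integral_eq_lintegral_ofReal]
  · simp only [heq]
    rw [integral_finsetSum _ fun k _ => hint k,
      Finset.sum_eq_single 0]
    · simp [walsh_zero]
    · intro k _ hk
      rw [integral_const_mul, integral_walsh_of_ne_zero hk, mul_zero]
    · simp
  · simp only [heq]
    exact integrable_finsetSum _ fun k _ => hint k
  · exact Filter.Eventually.of_forall fun x =>
      (hs.mul (isSign_radSeq x)).signDirichlet_two_pow_nonneg m

/-! ### Dyadic addition as multiplication of signs -/

lemma ofDigits_lt_one {d : ℕ → Fin 2} {k : ℕ} (hk : d k = 0) : Real.ofDigits d < 1 := by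
  rw [← Real.ofDigits_const_last_eq_one' one_lt_two]
  refine Summable.tsum_lt_tsum (i := k) (fun i => ?_) ?_ Real.summable_ofDigitsTerm
    Real.summable_ofDigitsTerm
  · refine mul_le_mul_of_nonneg_right ?_ (by positivity)
    have := (d i).isLt
    exact Nat.cast_le.mpr (by simp only; lia)
  · simp [Real.ofDigitsTerm, hk]

lemma digit_ofDigits {d : ℕ → Fin 2} (hd : ∀ K, ∃ k ≥ K, d k = 0) (k : ℕ) :
    digit (Real.ofDigits d) k = d k := by
  have hnat : ∀ k : ℕ, ∃ P : ℕ, 2 ^ k * ∑ i ∈ Finset.range k, Real.ofDigitsTerm d i = (P : ℝ) := by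
    intro k
    induction k with
    | zero => exact ⟨0, by simp⟩
    | succ k ih =>
      obtain ⟨P, hP⟩ := ih
      refine ⟨2 * P + d k, ?_⟩
      rw [Finset.sum_range_succ, mul_add, pow_succ', mul_assoc, hP, Real.ofDigitsTerm]
      push_cast
      field_simp
      ring
  obtain ⟨P, hP⟩ := hnat k
  obtain ⟨j, hj, hj0⟩ := hd (k + 1)
  have hlt : Real.ofDigits (fun i => d (i + (k + 1))) < 1 :=
    ofDigits_lt_one (k := j - (k + 1)) (by rwa [Nat.sub_add_cancel hj])
  have hval : Real.ofDigits d * 2 ^ (k + 1) =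
      (2 * P + d k : ℕ) + Real.ofDigits (fun i => d (i + (k + 1))) := by
    rw [Real.ofDigits_eq_sum_add_ofDigits d (k + 1), Finset.sum_range_succ, Real.ofDigitsTerm]
    push_cast
    rw [← hP]
    field_simp
    ring
  rw [digit_eq, hval, (Nat.floor_eq_iff (add_nonneg (Nat.cast_nonneg _)
    (Real.ofDigits_nonneg _))).mpr ⟨le_add_of_nonneg_right (Real.ofDigits_nonneg _),
      by linarith⟩]
  have := (d k).isLt
  lia

lemma radSeq_injOn : Set.InjOn radSeq (Set.Ico 0 1) := by
  intro x hx y hy h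
  rw [← Real.ofDigits_digits one_lt_two hx, ← Real.ofDigits_digits one_lt_two hy]
  congr 1
  funext k
  have hk : rademacher k x = rademacher k y := congrFun h k
  have hx2 := digit_lt_two x k
  have hy2 := digit_lt_two y k
  refine Fin.ext (?_ : digit x k = digit y k)
  rw [rademacher, rademacher] at hk
  interval_cases digit x k <;> interval_cases digit y k <;> first | rfl | norm_num at hk

lemma ae_radSeq_ne (s : ℕ → ℝ) : ∀ᵐ u ∂unitMeasure, radSeq u ≠ s := by
  rw [unitMeasure, ae_restrict_iff' measurableSet_Ico, ae_iff]
  refine Set.Subsingleton.measure_zero (fun u hu v hv => ?_) _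
  simp only [Set.mem_ofPred_eq, not_forall, not_not] at hu hv
  obtain ⟨hu, hus⟩ := hu
  obtain ⟨hv, hvs⟩ := hv
  exact radSeq_injOn hu hv (hus.trans hvs.symm)

/-- This fails only when the digitwise sum ends in ones, that is, when u has eventually the digits
opposite to those of x. There are countably many such u, indexed by the finite set where the digits
agree. -/
lemma radSeq_dyadicAdd (x : ℝ) :
    ∀ᵐ u ∂unitMeasure, radSeq (dyadicAdd x u) = radSeq x * radSeq u := by
  have hall : ∀ᵐ u ∂unitMeasure, ∀ F : Finset ℕ,
      radSeq u ≠ fun k => if k ∈ F then radSeq x k else -radSeq x k :=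
    ae_all_iff.mpr fun F => ae_radSeq_ne _
  filter_upwards [hall] with u hu
  set d : ℕ → Fin 2 := fun k => if digit x k = digit u k then 0 else 1 with hd
  have hadd : dyadicAdd x u = Real.ofDigits d := by
    rw [dyadicAdd, Real.ofDigits]
    refine tsum_congr fun k => ?_
    have hx2 := digit_lt_two x k
    have hu2 := digit_lt_two u k
    simp only [Real.ofDigitsTerm, hd]
    interval_cases digit x k <;> interval_cases digit u k <;> norm_num
  have hinf : ∀ K, ∃ k ≥ K, d k = 0 := by
    by_contra! hcon
    obtain ⟨K, hK⟩ := hcon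
    refine hu ((Finset.range K).filter fun k => radSeq u k = radSeq x k) ?_
    funext k
    simp only [Finset.mem_filter, Finset.mem_range]
    split_ifs with h
    · exact h.2
    · have hne : radSeq u k ≠ radSeq x k := by
        rcases lt_or_ge k K with hkK | hkK
        · exact fun h' => h ⟨hkK, h'⟩
        · intro h'
          refine hK k hkK ?_
          have hx2 := digit_lt_two x k
          have hu2 := digit_lt_two u k
          simp only [hd, radSeq, rademacher] at h' ⊢
          interval_cases digit x k <;> interval_cases digit u k <;> first | rfl | norm_num at h'
      rcases isSign_radSeq u k with h1 | h1 <;> rcases isSign_radSeq x k with h2 | h2 <;>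
        simp [h1, h2] at hne ⊢
  funext k
  have hx2 := digit_lt_two x k
  have hu2 := digit_lt_two u k
  rw [hadd, Pi.mul_apply, radSeq, radSeq, radSeq, rademacher, rademacher, rademacher,
    digit_ofDigits hinf]
  simp only [hd]
  interval_cases digit x k <;> interval_cases digit u k <;> norm_num

/-! ### Dyadic averages, flipped averages and the majorant -/

/-- The integral of `φ` against the kernel `g` translated dyadically to `x`. -/
noncomputable def signAvg (φ : ℝ → ℝ≥0∞) (x : ℝ) (g : (ℕ → ℝ) → ℝ) : ℝ≥0∞ :=
  ∫⁻ u, ENNReal.ofReal (g (radSeq x * radSeq u)) * φ u ∂unitMeasure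

/-- The averages of `φ` over the dyadic intervals of length `2 ^ (-m)`. -/
noncomputable def dyadicAvg (φ : ℝ → ℝ≥0∞) (m : ℕ) (x : ℝ) : ℝ≥0∞ :=
  signAvg φ x (signDirichlet (2 ^ m))

/-- The averages of `φ` over the dyadic interval of length `2 ^ (-m)` with the `i`-th digit
changed. -/
noncomputable def flipAvg (φ : ℝ → ℝ≥0∞) (m i : ℕ) (x : ℝ) : ℝ≥0∞ :=
  signAvg φ x fun s => signDirichlet (2 ^ m) (flipSign i s)

/-- The weighted mean of the averages with one digit changed. -/
noncomputable def flipMean (φ : ℝ → ℝ≥0∞) (m : ℕ) (x : ℝ) : ℝ≥0∞ :=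
  ∑ i ∈ Finset.range m, 2 ^ i / 2 ^ m * flipAvg φ m i x

/-- The maximal function which majorizes the maximal functions of the kernels. -/
noncomputable def majorant (φ : ℝ → ℝ≥0∞) (x : ℝ) : ℝ≥0∞ :=
  (⨆ m, dyadicAvg φ m x) + ⨆ m, flipMean φ m x

lemma flipSign_mul (i : ℕ) (r s : ℕ → ℝ) : flipSign i (r * s) = flipSign i r * s := by
  funext k
  by_cases h : k = i
  · subst h; simp [flipSign]
  · simp [flipSign, h]

lemma measurable_signAvg_kernel {φ : ℝ → ℝ≥0∞} (hφ : Measurable φ) {g : (ℕ → ℝ) → ℝ}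
    (hg : Measurable g) : Measurable fun p : ℝ × ℝ =>
      ENNReal.ofReal (g (radSeq p.1 * radSeq p.2)) * φ p.2 := by
  have h1 : Measurable fun p : ℝ × ℝ => radSeq p.1 * radSeq p.2 := by
    refine measurable_pi_lambda _ fun k => ?_
    exact ((measurable_pi_iff.mp measurable_radSeq k).comp measurable_fst).mul
      ((measurable_pi_iff.mp measurable_radSeq k).comp measurable_snd)
  exact (hg.comp h1).ennreal_ofReal.mul (hφ.comp measurable_snd)

lemma measurable_signAvg {φ : ℝ → ℝ≥0∞} (hφ : Measurable φ) {g : (ℕ → ℝ) → ℝ}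
    (hg : Measurable g) : Measurable fun x => signAvg φ x g :=
  (measurable_signAvg_kernel hφ hg).lintegral_prod_right'

lemma measurable_signAvg_integrand {φ : ℝ → ℝ≥0∞} (hφ : Measurable φ) {g : (ℕ → ℝ) → ℝ}
    (hg : Measurable g) (x : ℝ) :
    Measurable fun u => ENNReal.ofReal (g (radSeq x * radSeq u)) * φ u := by
  have := (measurable_signAvg_kernel hφ hg).comp (measurable_prodMk_left (x := x))
  simpa only [Function.comp_def] using this

lemma measurable_flipKernel (m i : ℕ) :
    Measurable fun s => signDirichlet (2 ^ m) (flipSign i s) :=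
  (measurable_signDirichlet _).comp (measurable_flipSign i)

lemma IsSign.eq_one_of_signDirichlet_ne_zero {r : ℕ → ℝ} {m : ℕ} (hr : IsSign r)
    (h : signDirichlet (2 ^ m) r ≠ 0) : ∀ j < m, r j = 1 := by
  intro j hj
  refine (hr j).resolve_right fun hneg => h ?_
  rw [hr.signDirichlet_two_pow]
  exact Finset.prod_eq_zero (Finset.mem_range.mpr hj) (by rw [hneg]; norm_num)

lemma IsSign.signDirichlet_two_pow_congr {r s : ℕ → ℝ} {m : ℕ} (hr : IsSign r) (hs : IsSign s)
    (h : ∀ j < m, r j = s j) : signDirichlet (2 ^ m) r = signDirichlet (2 ^ m) s := by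
  rw [hr.signDirichlet_two_pow, hs.signDirichlet_two_pow]
  exact Finset.prod_congr rfl fun j hj => by rw [h j (Finset.mem_range.mp hj)]

lemma dyadicAvg_congr (φ : ℝ → ℝ≥0∞) {m : ℕ} {x y : ℝ}
    (h : ∀ j < m, radSeq x j = radSeq y j) : dyadicAvg φ m x = dyadicAvg φ m y := by
  refine lintegral_congr fun u => ?_
  rw [((isSign_radSeq x).mul (isSign_radSeq u)).signDirichlet_two_pow_congr
    ((isSign_radSeq y).mul (isSign_radSeq u)) fun j hj => by
      rw [Pi.mul_apply, Pi.mul_apply, h j hj]]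

lemma lintegral_signAvg_flip {φ : ℝ → ℝ≥0∞} (hφ : Measurable φ) (m i : ℕ) :
    ∫⁻ x, flipAvg φ m i x ∂unitMeasure = ∫⁻ u, φ u ∂unitMeasure := by
  unfold flipAvg signAvg
  rw [lintegral_lintegral_swap
    (measurable_signAvg_kernel hφ (measurable_flipKernel m i)).aemeasurable]
  refine lintegral_congr fun u => ?_
  have hm : Measurable fun x : ℝ =>
      ENNReal.ofReal (signDirichlet (2 ^ m) (flipSign i (radSeq x * radSeq u))) := by
    have := (measurable_signAvg_kernel (φ := 1) measurable_const
      (measurable_flipKernel m i)).comp (measurable_prodMk_right (y := u))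
    simpa [Function.comp_def] using this
  rw [lintegral_mul_const _ hm]
  have h : ∀ x, flipSign i (radSeq x * radSeq u) = flipSign i (radSeq u) * radSeq x := fun x => by
    rw [mul_comm, flipSign_mul]
  simp only [h]
  rw [lintegral_signDirichlet_two_pow ((isSign_radSeq u).flip i), one_mul]

lemma sum_two_pow_div_le_one (m : ℕ) :
    ∑ i ∈ Finset.range m, (2 : ℝ≥0∞) ^ i / 2 ^ m ≤ 1 := by
  have h : ∀ m : ℕ, ∑ i ∈ Finset.range m, (2 : ℝ≥0∞) ^ i ≤ 2 ^ m := by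
    intro m
    induction m with
    | zero => simp
    | succ m ih =>
      rw [Finset.sum_range_succ, pow_succ, mul_two]
      exact add_le_add_left ih _
  simp only [div_eq_mul_inv]
  rw [← Finset.sum_mul, ← div_eq_mul_inv]
  exact ENNReal.div_le_of_le_mul (by rw [one_mul]; exact h m)

/-- Each average has a kernel of total mass 1 and the weights 2^{i-m} sum to at most 1, so each of
the two suprema is at most K. -/
lemma majorant_le_of_ae_le {φ : ℝ → ℝ≥0∞} {K : ℝ≥0∞} (h : ∀ᵐ u ∂unitMeasure, φ u ≤ K) (x : ℝ) :
    majorant φ x ≤ 2 * K := by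
  have key : ∀ (g : (ℕ → ℝ) → ℝ), Measurable g →
      ∫⁻ u, ENNReal.ofReal (g (radSeq x * radSeq u)) ∂unitMeasure = 1 → signAvg φ x g ≤ K := by
    intro g hg h1
    have hm := measurable_signAvg_integrand (φ := 1) measurable_const hg x
    simp only [Pi.one_apply, mul_one] at hm
    calc signAvg φ x g ≤
        ∫⁻ u, ENNReal.ofReal (g (radSeq x * radSeq u)) * K ∂unitMeasure := by
          refine lintegral_mono_ae ?_
          filter_upwards [h] with u hu
          gcongr
      _ = K := by rw [lintegral_mul_const _ hm, h1, one_mul]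
  rw [majorant, two_mul]
  refine add_le_add (iSup_le fun m => ?_) (iSup_le fun m => ?_)
  · exact key _ (measurable_signDirichlet _) (lintegral_signDirichlet_two_pow (isSign_radSeq x) m)
  · calc flipMean φ m x ≤ ∑ i ∈ Finset.range m, 2 ^ i / 2 ^ m * K := by
          refine Finset.sum_le_sum fun i _ => ?_
          gcongr
          refine key _ (measurable_flipKernel m i) ?_
          simp only [flipSign_mul]
          exact lintegral_signDirichlet_two_pow ((isSign_radSeq x).flip i) m
      _ ≤ K := by
          rw [← Finset.sum_mul]
          exact mul_le_of_le_one_left' (sum_two_pow_div_le_one m)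

/-! ### Weak type (1,1) of the majorant by stopping times -/

section WeakType

variable {φ : ℝ → ℝ≥0∞} {c : ℝ≥0∞}

/-- The points at which `N` is the first index such that the dyadic average exceeds `c`. -/
def stopSet (φ : ℝ → ℝ≥0∞) (c : ℝ≥0∞) (N : ℕ) : Set ℝ :=
  {x | c < dyadicAvg φ N x ∧ ∀ k < N, dyadicAvg φ k x ≤ c}

lemma measurableSet_stopSet (hφ : Measurable φ) (c : ℝ≥0∞) (N : ℕ) :
    MeasurableSet (stopSet φ c N) := by
  have hm : ∀ k, Measurable (dyadicAvg φ k) := fun k =>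
    measurable_signAvg hφ (measurable_signDirichlet _)
  refine (measurableSet_lt measurable_const (hm N)).inter ?_
  have : {x | ∀ k < N, dyadicAvg φ k x ≤ c} = ⋂ k, ⋂ (_ : k < N), {x | dyadicAvg φ k x ≤ c} := by
    ext x; simp
  change MeasurableSet {x | ∀ k < N, dyadicAvg φ k x ≤ c}
  rw [this]
  exact MeasurableSet.iInter fun k => MeasurableSet.iInter fun _ =>
    measurableSet_le (hm k) measurable_const

lemma pairwise_disjoint_stopSet (φ : ℝ → ℝ≥0∞) (c : ℝ≥0∞) :
    Pairwise (Function.onFun Disjoint (stopSet φ c)) := by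
  intro M N hMN
  refine Set.disjoint_left.mpr fun x hM hN => ?_
  rcases lt_or_gt_of_ne hMN with h | h
  · exact (hN.2 M h).not_gt hM.1
  · exact (hM.2 N h).not_gt hN.1

lemma exists_mem_stopSet {m : ℕ} {x : ℝ} (h : c < dyadicAvg φ m x) :
    ∃ N ≤ m, x ∈ stopSet φ c N := by
  classical
  have hex : ∃ N, c < dyadicAvg φ N x := ⟨m, h⟩
  exact ⟨Nat.find hex, Nat.find_min' hex h, Nat.find_spec hex,
    fun k hk => not_lt.mp (Nat.find_min hex hk)⟩

lemma mem_stopSet_congr {N : ℕ} {x y : ℝ} (h : ∀ j < N, radSeq x j = radSeq y j)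
    (hx : x ∈ stopSet φ c N) : y ∈ stopSet φ c N := by
  refine ⟨?_, fun k hk => ?_⟩
  · rw [← dyadicAvg_congr φ h]; exact hx.1
  · rw [← dyadicAvg_congr φ fun j hj => h j (hj.trans hk)]; exact hx.2 k hk

/-- The stopping set of level N is a union of dyadic intervals of length 2^{-N}, so averaging at
level N at a point of it only sees φ on it. -/
lemma mul_measure_stopSet_le (hφ : Measurable φ) (N : ℕ) :
    c * unitMeasure (stopSet φ c N) ≤ ∫⁻ u in stopSet φ c N, φ u ∂unitMeasure := by
  have hA := measurableSet_stopSet hφ c N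
  have hφA : Measurable ((stopSet φ c N).indicator φ) := hφ.indicator hA
  calc c * unitMeasure (stopSet φ c N)
      = ∫⁻ _ in stopSet φ c N, c ∂unitMeasure := by rw [setLIntegral_const]
    _ ≤ ∫⁻ x in stopSet φ c N, dyadicAvg φ N x ∂unitMeasure :=
        setLIntegral_mono' hA fun x hx => hx.1.le
    _ ≤ ∫⁻ x, dyadicAvg ((stopSet φ c N).indicator φ) N x ∂unitMeasure := by
        rw [← lintegral_indicator hA]
        refine lintegral_mono fun x => ?_
        by_cases hx : x ∈ stopSet φ c N
        · rw [Set.indicator_of_mem hx]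
          refine lintegral_mono fun u => ?_
          by_cases h0 : signDirichlet (2 ^ N) (radSeq x * radSeq u) = 0
          · simp [h0]
          · have h1 := ((isSign_radSeq x).mul (isSign_radSeq u)).eq_one_of_signDirichlet_ne_zero h0
            have hu : u ∈ stopSet φ c N := by
              refine mem_stopSet_congr (fun j hj => ?_) hx
              have h2 := h1 j hj
              have h3 := (isSign_radSeq u).mul_self j
              rw [Pi.mul_apply] at h2
              linear_combination radSeq u j * h2 - radSeq x j * h3
            simp only
            rw [Set.indicator_of_mem hu]
        · rw [Set.indicator_of_notMem hx]; exact zero_le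
    _ = ∫⁻ u in stopSet φ c N, φ u ∂unitMeasure := by
        unfold dyadicAvg signAvg
        rw [lintegral_lintegral_swap
          (measurable_signAvg_kernel hφA (measurable_signDirichlet _)).aemeasurable,
          ← lintegral_indicator hA]
        refine lintegral_congr fun u => ?_
        have hm : Measurable fun x : ℝ =>
            ENNReal.ofReal (signDirichlet (2 ^ N) (radSeq x * radSeq u)) := by
          have := (measurable_signAvg_kernel (φ := 1) measurable_const
            (measurable_signDirichlet (2 ^ N))).comp (measurable_prodMk_right (y := u))
          simpa [Function.comp_def] using this
        rw [lintegral_mul_const _ hm]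
        simp only [mul_comm (radSeq _) (radSeq u)]
        rw [lintegral_signDirichlet_two_pow (isSign_radSeq u), one_mul]

lemma tsum_setLIntegral_stopSet_le (hφ : Measurable φ) :
    ∑' N, ∫⁻ u in stopSet φ c N, φ u ∂unitMeasure ≤ ∫⁻ u, φ u ∂unitMeasure := by
  rw [← lintegral_iUnion (measurableSet_stopSet hφ c) (pairwise_disjoint_stopSet φ c)]
  exact setLIntegral_le_lintegral _ _

/-- The contribution to the means with one digit changed of the part of `φ` which lives on the
dyadic intervals with large averages. -/
noncomputable def stoppedPart (φ : ℝ → ℝ≥0∞) (c : ℝ≥0∞) (x : ℝ) : ℝ≥0∞ :=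
  ∑' N, ∑' p, ∑ i ∈ Finset.range N,
    2 ^ i / 2 ^ (N + p) * flipAvg ((stopSet φ c N).indicator φ) (N + p) i x

lemma measurable_stoppedPart (hφ : Measurable φ) (c : ℝ≥0∞) : Measurable (stoppedPart φ c) := by
  refine Measurable.tsum fun N => Measurable.tsum fun p =>
    Finset.measurable_fun_sum _ fun i _ => Measurable.const_mul ?_ _
  exact measurable_signAvg (hφ.indicator (measurableSet_stopSet hφ c N))
    (measurable_flipKernel _ i)

/-- Flipped averages preserve integrals. Since only i < N occurs, the weights 2^{i-N-p} sum to at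
most 2^{-p}, and summing over p gives the factor 2. -/
lemma lintegral_stoppedPart_le (hφ : Measurable φ) (c : ℝ≥0∞) :
    ∫⁻ x, stoppedPart φ c x ∂unitMeasure ≤ 2 * ∫⁻ u, φ u ∂unitMeasure := by
  have hφA : ∀ N, Measurable ((stopSet φ c N).indicator φ) := fun N =>
    hφ.indicator (measurableSet_stopSet hφ c N)
  have hm : ∀ N p i, Measurable fun x => (2 : ℝ≥0∞) ^ i / 2 ^ (N + p) *
      flipAvg ((stopSet φ c N).indicator φ) (N + p) i x := fun N p i =>
    (measurable_signAvg (hφA N) (measurable_flipKernel _ i)).const_mul _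
  have hs : ∀ N p, Measurable fun x => ∑ i ∈ Finset.range N, (2 : ℝ≥0∞) ^ i / 2 ^ (N + p) *
      flipAvg ((stopSet φ c N).indicator φ) (N + p) i x := fun N p =>
    Finset.measurable_fun_sum _ fun i _ => hm N p i
  unfold stoppedPart
  rw [lintegral_tsum fun N => (Measurable.tsum fun p => hs N p).aemeasurable]
  refine le_trans (ENNReal.tsum_le_tsum fun N => ?_)
    ((ENNReal.tsum_mul_left (a := 2)).trans_le
      (mul_le_mul_right (tsum_setLIntegral_stopSet_le (c := c) hφ) 2))
  rw [lintegral_tsum fun p => (hs N p).aemeasurable]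
  calc _ ≤ ∑' p : ℕ, (2⁻¹ : ℝ≥0∞) ^ p * ∫⁻ u in stopSet φ c N, φ u ∂unitMeasure := by
        refine ENNReal.tsum_le_tsum fun p => ?_
        rw [lintegral_finsetSum _ fun i _ => hm N p i]
        have hterm : ∀ i, ∫⁻ x, (2 : ℝ≥0∞) ^ i / 2 ^ (N + p) *
            flipAvg ((stopSet φ c N).indicator φ) (N + p) i x ∂unitMeasure =
            2 ^ i / 2 ^ (N + p) * ∫⁻ u in stopSet φ c N, φ u ∂unitMeasure := fun i => by
          rw [lintegral_const_mul _ (by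
              exact measurable_signAvg (hφA N) (measurable_flipKernel (N + p) i)),
            lintegral_signAvg_flip (hφA N), lintegral_indicator (measurableSet_stopSet hφ c N)]
        rw [Finset.sum_congr rfl fun i _ => hterm i, ← Finset.sum_mul]
        gcongr
        calc ∑ i ∈ Finset.range N, (2 : ℝ≥0∞) ^ i / 2 ^ (N + p)
            = 2⁻¹ ^ p * ∑ i ∈ Finset.range N, (2 : ℝ≥0∞) ^ i / 2 ^ N := by
              rw [Finset.mul_sum]
              refine Finset.sum_congr rfl fun i _ => ?_
              rw [pow_add, div_eq_mul_inv, div_eq_mul_inv,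
                ENNReal.mul_inv (by simp) (by simp), ENNReal.inv_pow (n := p)]
              ring
          _ ≤ 2⁻¹ ^ p := mul_le_of_le_one_right' (sum_two_pow_div_le_one N)
    _ = 2 * ∫⁻ u in stopSet φ c N, φ u ∂unitMeasure := by
        rw [ENNReal.tsum_mul_right, ENNReal.tsum_geometric, ENNReal.one_sub_inv_two, inv_inv]

/-- The flipped interval shares its first i digits with x. A stopping interval of level N ≤ i
containing it would also contain x, so only levels N > i contribute. This restriction is what makes
the stopped part integrable uniformly. -/
lemma flipAvg_le_add (hφ : Measurable φ) {x : ℝ} (hx : ∀ N, x ∉ stopSet φ c N) (m i : ℕ) :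
    flipAvg φ m i x ≤ c + ∑ N ∈ (Finset.range (m + 1)).filter (i < ·),
      flipAvg ((stopSet φ c N).indicator φ) m i x := by
  set k : ℝ → ℝ≥0∞ := fun u =>
    ENNReal.ofReal (signDirichlet (2 ^ m) (flipSign i (radSeq x * radSeq u))) with hk
  have hsign : ∀ u, IsSign (flipSign i (radSeq x * radSeq u)) := fun u =>
    ((isSign_radSeq x).mul (isSign_radSeq u)).flip i
  set B : Set ℝ := ⋃ N ∈ Finset.range (m + 1), stopSet φ c N with hB
  have hBm : MeasurableSet B := Finset.measurableSet_biUnion _ fun N _ =>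
    measurableSet_stopSet hφ c N
  have hkm : Measurable fun u => k u * φ u :=
    measurable_signAvg_integrand hφ (measurable_flipKernel m i) x
  have hsplit : flipAvg φ m i x =
      ∫⁻ u in Bᶜ, k u * φ u ∂unitMeasure + ∫⁻ u in B, k u * φ u ∂unitMeasure := by
    rw [add_comm, lintegral_add_compl _ hBm]; rfl
  rw [hsplit]
  refine add_le_add ?_ ?_
  -- If the flipped interval has a point u₀ outside B, it is the level-m interval of u₀, whose
  -- average is at most c because u₀ has not stopped by level m.
  · by_cases hex : ∃ u₀ ∈ Bᶜ, k u₀ ≠ 0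
    · obtain ⟨u₀, hu₀, hne⟩ := hex
      have h1 := (hsign u₀).eq_one_of_signDirichlet_ne_zero (m := m) fun h0 => hne (by simp [hk, h0])
      have hle : dyadicAvg φ m u₀ ≤ c := by
        by_contra hcon
        obtain ⟨N, hN, hmem⟩ := exists_mem_stopSet (not_le.mp hcon)
        exact hu₀ (Set.mem_biUnion (Finset.mem_coe.mpr (Finset.mem_range_succ_iff.mpr hN)) hmem)
      refine (setLIntegral_le_lintegral _ _).trans (le_trans (le_of_eq ?_) hle)
      refine lintegral_congr fun u => ?_
      simp only [hk]
      rw [(hsign u).signDirichlet_two_pow_congr ((isSign_radSeq u₀).mul (isSign_radSeq u))]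
      intro j hj
      have h2 := h1 j hj
      have h3 := (isSign_radSeq u₀).mul_self j
      rw [flipSign_mul, Pi.mul_apply] at h2 ⊢
      rw [Pi.mul_apply]
      linear_combination radSeq u₀ j * radSeq u j * h2 -
        flipSign i (radSeq x) j * radSeq u j * h3
    · push Not at hex
      rw [setLIntegral_congr_fun (g := fun _ => 0) hBm.compl fun u hu => by simp [hex u hu]]
      simp
  · rw [← lintegral_indicator hBm]
    calc ∫⁻ u, B.indicator (fun u => k u * φ u) u ∂unitMeasure
        ≤ ∫⁻ u, ∑ N ∈ (Finset.range (m + 1)).filter (i < ·),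
            k u * (stopSet φ c N).indicator φ u ∂unitMeasure := by
          refine lintegral_mono fun u => ?_
          by_cases hu : u ∈ B
          · rw [Set.indicator_of_mem hu]
            obtain ⟨N, hN, hmem⟩ := Set.mem_iUnion₂.mp hu
            by_cases hk0 : k u = 0
            · simp [hk0]
            · have h1 := (hsign u).eq_one_of_signDirichlet_ne_zero (m := m)
                fun h0 => hk0 (by simp [hk, h0])
              have hi : i < N := by
                by_contra hcon
                refine hx N (mem_stopSet_congr (fun j hj => ?_) hmem)
                have h2 := h1 j (by have := Finset.mem_range.mp hN; lia)
                rw [flipSign_of_ne (by lia), Pi.mul_apply] at h2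
                have h3 := (isSign_radSeq u).mul_self j
                linear_combination radSeq x j * h3 - radSeq u j * h2
              refine le_trans (le_of_eq ?_) (Finset.single_le_sum
                (f := fun N => k u * (stopSet φ c N).indicator φ u) (fun _ _ => zero_le)
                (Finset.mem_filter.mpr ⟨hN, hi⟩))
              simp only
              rw [Set.indicator_of_mem hmem]
          · rw [Set.indicator_of_notMem hu]; exact zero_le
      _ = _ := by
          rw [lintegral_finsetSum]
          · rfl
          · exact fun N _ => measurable_signAvg_integrand
              (hφ.indicator (measurableSet_stopSet hφ c N)) (measurable_flipKernel m i) x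

lemma flipMean_le_add (hφ : Measurable φ) {x : ℝ} (hx : ∀ N, x ∉ stopSet φ c N) (m : ℕ) :
    flipMean φ m x ≤ c + stoppedPart φ c x := by
  calc flipMean φ m x
      ≤ ∑ i ∈ Finset.range m, (2 ^ i / 2 ^ m * c +
        ∑ N ∈ Finset.range (m + 1), if i < N then
          2 ^ i / 2 ^ m * flipAvg ((stopSet φ c N).indicator φ) m i x else 0) := by
        refine Finset.sum_le_sum fun i _ => ?_
        rw [← Finset.sum_filter, ← Finset.mul_sum, ← mul_add]
        gcongr
        exact flipAvg_le_add hφ hx m i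
    _ ≤ c + ∑ N ∈ Finset.range (m + 1), ∑ i ∈ Finset.range N,
          2 ^ i / 2 ^ m * flipAvg ((stopSet φ c N).indicator φ) m i x := by
        rw [Finset.sum_add_distrib, ← Finset.sum_mul, Finset.sum_comm]
        refine add_le_add (mul_le_of_le_one_left' (sum_two_pow_div_le_one m))
          (Finset.sum_le_sum fun N _ => ?_)
        rw [← Finset.sum_filter]
        refine Finset.sum_le_sum_of_subset fun i hi => ?_
        exact Finset.mem_range.mpr (Finset.mem_filter.mp hi).2
    _ ≤ c + stoppedPart φ c x := by
        gcongr
        refine le_trans (Finset.sum_le_sum fun N hN => ?_)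
          (ENNReal.sum_le_tsum (Finset.range (m + 1)))
        have hm : m = N + (m - N) := by have := Finset.mem_range.mp hN; lia
        have := ENNReal.le_tsum (f := fun p => ∑ i ∈ Finset.range N,
          2 ^ i / 2 ^ (N + p) * flipAvg ((stopSet φ c N).indicator φ) (N + p) i x) (m - N)
        rwa [← hm] at this

/-- Off the stopping sets the dyadic averages are at most c and the flipped means at most c plus the
stopped part. So exceeding 3c forces stopping (cost ∫φ) or a stopped part of size at least c (cost
2∫φ by Markov). -/
theorem mul_measure_majorant_gt_le (hφ : Measurable φ) (c : ℝ≥0∞) :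
    c * unitMeasure {x | 3 * c < majorant φ x} ≤ 3 * ∫⁻ u, φ u ∂unitMeasure := by
  have hsub : {x | 3 * c < majorant φ x} ⊆
      (⋃ N, stopSet φ c N) ∪ {x | c ≤ stoppedPart φ c x} := by
    intro x hx
    by_contra hcon
    simp only [Set.mem_union, Set.mem_iUnion, not_or, not_exists, Set.mem_ofPred_eq, not_le] at hcon
    obtain ⟨h1, h2⟩ := hcon
    rw [Set.mem_ofPred_eq] at hx
    refine (lt_irrefl _ (lt_of_lt_of_le hx ?_))
    have h3 : (3 : ℝ≥0∞) * c = c + (c + c) := by ring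
    rw [h3, majorant]
    refine add_le_add (iSup_le fun m => ?_) (iSup_le fun m => ?_)
    · by_contra hc
      obtain ⟨N, -, hN⟩ := exists_mem_stopSet (not_le.mp hc)
      exact h1 N hN
    · exact (flipMean_le_add hφ h1 m).trans (by gcongr)
  calc c * unitMeasure {x | 3 * c < majorant φ x}
      ≤ c * (∑' N, unitMeasure (stopSet φ c N) + unitMeasure {x | c ≤ stoppedPart φ c x}) := by
        gcongr
        exact (measure_mono hsub).trans ((measure_union_le _ _).trans
          (add_le_add_left (measure_iUnion_le _) _))
    _ = ∑' N, c * unitMeasure (stopSet φ c N) +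
          c * unitMeasure {x | c ≤ stoppedPart φ c x} := by
        rw [mul_add, ENNReal.tsum_mul_left]
    _ ≤ ∫⁻ u, φ u ∂unitMeasure + 2 * ∫⁻ u, φ u ∂unitMeasure := by
        refine add_le_add ?_ ?_
        · exact (ENNReal.tsum_le_tsum fun N => mul_measure_stopSet_le hφ N).trans
            (tsum_setLIntegral_stopSet_le hφ)
        · exact (mul_meas_ge_le_lintegral (measurable_stoppedPart hφ c) c).trans
            (lintegral_stoppedPart_le hφ c)
    _ = 3 * ∫⁻ u, φ u ∂unitMeasure := by ring

end WeakType

/-! ### From the kernel bound to the maximal operator -/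

/-- `g` is a nonnegative kernel, whose means of `φ` at `x` are at most `B` times the majorant. -/
structure MeanLE (φ : ℝ → ℝ≥0∞) (x : ℝ) (g : (ℕ → ℝ) → ℝ) (B : ℝ) : Prop where
  measurable : Measurable g
  nonneg : ∀ r, IsSign r → 0 ≤ g r
  bound_nonneg : 0 ≤ B
  le : signAvg φ x g ≤ ENNReal.ofReal B * majorant φ x

section Mean

variable {φ : ℝ → ℝ≥0∞} {x : ℝ}

lemma signAvg_add (hφ : Measurable φ) {g h : (ℕ → ℝ) → ℝ} (hg : Measurable g)
    (hg0 : ∀ r, IsSign r → 0 ≤ g r) (hh0 : ∀ r, IsSign r → 0 ≤ h r) :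
    signAvg φ x (fun r => g r + h r) = signAvg φ x g + signAvg φ x h := by
  rw [signAvg, signAvg, signAvg, ← lintegral_add_left (measurable_signAvg_integrand hφ hg x)]
  refine lintegral_congr fun u => ?_
  have hs := (isSign_radSeq x).mul (isSign_radSeq u)
  rw [ENNReal.ofReal_add (hg0 _ hs) (hh0 _ hs), add_mul]

lemma signAvg_const_mul (hφ : Measurable φ) {g : (ℕ → ℝ) → ℝ} (hg : Measurable g) {a : ℝ}
    (ha : 0 ≤ a) : signAvg φ x (fun r => a * g r) = ENNReal.ofReal a * signAvg φ x g := by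
  rw [signAvg, signAvg, ← lintegral_const_mul _ (measurable_signAvg_integrand hφ hg x)]
  refine lintegral_congr fun u => ?_
  rw [ENNReal.ofReal_mul ha, mul_assoc]

lemma signAvg_mono {g h : (ℕ → ℝ) → ℝ} (hgh : ∀ r, IsSign r → g r ≤ h r) :
    signAvg φ x g ≤ signAvg φ x h := by
  refine lintegral_mono fun u => ?_
  exact mul_le_mul_left
    (ENNReal.ofReal_le_ofReal (hgh _ ((isSign_radSeq x).mul (isSign_radSeq u)))) _

lemma MeanLE.add (hφ : Measurable φ) {g h : (ℕ → ℝ) → ℝ} {B C : ℝ} (hg : MeanLE φ x g B)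
    (hh : MeanLE φ x h C) : MeanLE φ x (fun r => g r + h r) (B + C) where
  measurable := hg.measurable.add hh.measurable
  nonneg r hr := add_nonneg (hg.nonneg r hr) (hh.nonneg r hr)
  bound_nonneg := add_nonneg hg.bound_nonneg hh.bound_nonneg
  le := by
    rw [signAvg_add hφ hg.measurable hg.nonneg hh.nonneg,
      ENNReal.ofReal_add hg.bound_nonneg hh.bound_nonneg, add_mul]
    exact add_le_add hg.le hh.le

lemma MeanLE.const_mul (hφ : Measurable φ) {g : (ℕ → ℝ) → ℝ} {B a : ℝ} (ha : 0 ≤ a)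
    (hg : MeanLE φ x g B) : MeanLE φ x (fun r => a * g r) (a * B) where
  measurable := hg.measurable.const_mul a
  nonneg r hr := mul_nonneg ha (hg.nonneg r hr)
  bound_nonneg := mul_nonneg ha hg.bound_nonneg
  le := by
    rw [signAvg_const_mul hφ hg.measurable ha, ENNReal.ofReal_mul ha, mul_assoc]
    gcongr
    exact hg.le

lemma MeanLE.sum (hφ : Measurable φ) {g : ℕ → (ℕ → ℝ) → ℝ} {B : ℕ → ℝ} (s : Finset ℕ)
    (hg : ∀ i, MeanLE φ x (g i) (B i)) :
    MeanLE φ x (fun r => ∑ i ∈ s, g i r) (∑ i ∈ s, B i) := by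
  classical
  induction s using Finset.induction_on with
  | empty =>
    exact ⟨by simp, by simp, by simp, by simp [signAvg]⟩
  | insert i s hi ih =>
    simp only [Finset.sum_insert hi]
    exact (hg i).add hφ ih

lemma meanLE_signDirichlet (φ : ℝ → ℝ≥0∞) (x : ℝ) (m : ℕ) :
    MeanLE φ x (signDirichlet (2 ^ m)) 1 where
  measurable := measurable_signDirichlet _
  nonneg _ hr := hr.signDirichlet_two_pow_nonneg m
  bound_nonneg := zero_le_one
  le := by
    rw [ENNReal.ofReal_one, one_mul]
    exact (le_iSup (fun m => dyadicAvg φ m x) m).trans le_self_add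

lemma meanLE_signFejer (hφ : Measurable φ) (x : ℝ) (m : ℕ) :
    MeanLE φ x (signFejer (2 ^ m)) (2 ^ m) where
  measurable := measurable_signFejer _
  nonneg _ hr := hr.signFejer_two_pow_nonneg m
  bound_nonneg := by positivity
  le := by
    have hD := measurable_signDirichlet (2 ^ m)
    have hsum : ∀ s : Finset ℕ, signAvg φ x (fun r => ∑ i ∈ s, 2 ^ i *
        (signDirichlet (2 ^ m) r + signDirichlet (2 ^ m) (flipSign i r))) =
        ∑ i ∈ s, 2 ^ i * (dyadicAvg φ m x + flipAvg φ m i x) := by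
      classical
      intro s
      have hnn : ∀ i : ℕ, ∀ r, IsSign r → (0 : ℝ) ≤ 2 ^ i *
          (signDirichlet (2 ^ m) r + signDirichlet (2 ^ m) (flipSign i r)) := fun i r hr =>
        mul_nonneg (by positivity) (add_nonneg (hr.signDirichlet_two_pow_nonneg m)
          ((hr.flip i).signDirichlet_two_pow_nonneg m))
      have hm : ∀ i : ℕ, Measurable fun r =>
          signDirichlet (2 ^ m) r + signDirichlet (2 ^ m) (flipSign i r) := fun i =>
        hD.add (measurable_flipKernel m i)
      induction s using Finset.induction_on with
      | empty => simp [signAvg]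
      | insert i s hi ih =>
        simp only [Finset.sum_insert hi]
        rw [signAvg_add hφ ((hm i).const_mul _) (hnn i)
          fun r hr => Finset.sum_nonneg fun i _ => hnn i r hr, ih,
          signAvg_const_mul hφ (hm i) (by positivity), signAvg_add hφ hD
          (fun r hr => hr.signDirichlet_two_pow_nonneg m)
          (fun r hr => (hr.flip i).signDirichlet_two_pow_nonneg m),
          ENNReal.ofReal_pow zero_le_two, ENNReal.ofReal_ofNat]
        rfl
    have hpow : ∀ i : ℕ, (2 : ℝ≥0∞) ^ i = 2 ^ m * (2 ^ i / 2 ^ m) := fun i =>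
      (ENNReal.mul_div_cancel (by simp) (by simp)).symm
    calc signAvg φ x (signFejer (2 ^ m))
        ≤ signAvg φ x (fun r => ∑ i ∈ Finset.range m, 2 ^ i *
          (signDirichlet (2 ^ m) r + signDirichlet (2 ^ m) (flipSign i r))) := by
          refine signAvg_mono fun r hr => ?_
          rw [hr.signFejer_two_pow]
          refine Finset.sum_le_sum fun i _ => mul_le_mul_of_nonneg_right
            (half_le_self (by positivity)) (add_nonneg (hr.signDirichlet_two_pow_nonneg m)
              ((hr.flip i).signDirichlet_two_pow_nonneg m))
      _ = 2 ^ m * ((∑ i ∈ Finset.range m, 2 ^ i / 2 ^ m) * dyadicAvg φ m x +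
            flipMean φ m x) := by
          rw [hsum, flipMean, Finset.sum_mul, ← Finset.sum_add_distrib, Finset.mul_sum]
          refine Finset.sum_congr rfl fun i _ => ?_
          conv_lhs => rw [hpow i]
          ring
      _ ≤ 2 ^ m * (dyadicAvg φ m x + flipMean φ m x) := by
          gcongr
          exact mul_le_of_le_one_left' (sum_two_pow_div_le_one m)
      _ ≤ ENNReal.ofReal (2 ^ m) * majorant φ x := by
          rw [ENNReal.ofReal_pow zero_le_two, ENNReal.ofReal_ofNat]
          gcongr
          exact add_le_add (le_iSup (fun m => dyadicAvg φ m x) m)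
            (le_iSup (fun m => flipMean φ m x) m)

lemma signAvg_abs_signKernelV_le (hφ : Measurable φ) (x : ℝ) {t : ℕ → ℕ → ℝ}
    (ht : IsTransformationMatrix t) (n : ℕ) :
    signAvg φ x (fun r => |signKernelV t n r|) ≤
      ENNReal.ofReal (17 + upsilon t n) * majorant φ x := by
  have hs := truncDiff_nonneg (a := (t · n)) (ht.nonneg · n) (ht.antitone · n) n
  have hD := meanLE_signDirichlet φ x
  have hM := MeanLE.sum hφ (Finset.range (n + 1)) fun j =>
    ((((hD (Nat.clog 2 (j + 1))).add hφ
      (MeanLE.sum hφ (Finset.Ico (Nat.clog 2 (j + 1)) (Nat.log 2 n + 1)) fun k =>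
        (hD (k + 1)).const_mul hφ (abs_nonneg ((binCoeff k n : ℝ) - binCoeff (k + 1) n)))).const_mul
      hφ (by positivity : (0 : ℝ) ≤ (j + 1 : ℝ))).add hφ
      ((MeanLE.sum hφ (Finset.range (Nat.clog 2 (j + 1) + 1)) fun i =>
        (meanLE_signFejer hφ x i).add hφ
          ((hD i).const_mul hφ (by positivity : (0 : ℝ) ≤ 2 ^ i))).const_mul hφ
            zero_le_two)).const_mul hφ (hs j)
  calc signAvg φ x (fun r => |signKernelV t n r|) ≤ _ :=
        signAvg_mono fun r hr => hr.abs_signKernelV_le ht n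
    _ ≤ _ := hM.le
    _ ≤ _ := by
        gcongr
        exact sum_truncDiff_bound_le ht n

end Mean

lemma enorm_absKernelMean_le {f : ℝ → ℝ} {φ : ℝ → ℝ≥0∞} (hφ : Measurable φ)
    (hfφ : (fun u => ‖f u‖ₑ) =ᵐ[unitMeasure] φ) {t : ℕ → ℕ → ℝ}
    (ht : IsTransformationMatrix t) (n : ℕ) (x : ℝ) :
    ‖absKernelMean t n f x‖ₑ ≤ ENNReal.ofReal (17 + upsilon t n) * majorant φ x := by
  refine le_trans ?_ (signAvg_abs_signKernelV_le hφ x ht n)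
  refine (enorm_integral_le_lintegral_enorm _).trans (le_of_eq ?_)
  refine lintegral_congr_ae ?_
  filter_upwards [hfφ, radSeq_dyadicAdd x] with u hu hx
  rw [enorm_mul, hu, kernelV_eq, hx, Real.enorm_of_nonneg (abs_nonneg _), mul_comm]

theorem weakL1Norm_maximalFun_le {t : ℕ → ℕ → ℝ} (ht : IsTransformationMatrix t) {n : ℕ → ℕ}
    {B : ℝ≥0} (hB : ∀ b, upsilon t (n b) ≤ B) {f : ℝ → ℝ} (hf : Integrable f unitMeasure) :
    weakL1Norm (maximalFun t n f) ≤ (9 * (17 + B) : ℝ≥0) * eLpNorm f 1 unitMeasure := by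
  have hm : AEMeasurable (fun u => ‖f u‖ₑ) unitMeasure := hf.aestronglyMeasurable.enorm
  set φ := hm.mk _ with hφ
  have hφm : Measurable φ := hm.measurable_mk
  have hint : ∫⁻ u, φ u ∂unitMeasure = eLpNorm f 1 unitMeasure := by
    rw [eLpNorm_one_eq_lintegral_enorm]
    exact lintegral_congr_ae hm.ae_eq_mk.symm
  have hle : ∀ x, maximalFun t n f x ≤ (17 + B : ℝ≥0) * majorant φ x := fun x => by
    refine iSup_le fun b => (enorm_absKernelMean_le hφm hm.ae_eq_mk ht (n b) x).trans ?_
    gcongr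
    rw [← ENNReal.ofReal_coe_nnreal]
    refine ENNReal.ofReal_le_ofReal ?_
    push_cast
    linarith [hB b]
  refine iSup₂_le fun s hs => ?_
  set D : ℝ≥0 := 17 + B with hD
  have hD0 : D ≠ 0 := by positivity
  -- With s = 3Dc, the level s of the maximal function falls under level 3c of the majorant. The 9
  -- is this 3 times the weak-type constant 3.
  set c : ℝ≥0 := s / (3 * D) with hc
  have hcs : (s : ℝ≥0∞) = D * (3 * c) := by
    rw [hc]
    norm_cast
    field_simp
  have hsub : {x | (s : ℝ≥0∞) < maximalFun t n f x} ⊆ {x | 3 * (c : ℝ≥0∞) < majorant φ x} := by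
    intro x hx
    simp only [Set.mem_ofPred_eq] at hx ⊢
    by_contra hcon
    refine lt_irrefl _ (hx.trans_le ((hle x).trans ?_))
    rw [hcs]
    gcongr
    exact not_lt.mp hcon
  calc (s : ℝ≥0∞) * unitMeasure {x | (s : ℝ≥0∞) < maximalFun t n f x}
      ≤ D * (3 * c) * unitMeasure {x | 3 * (c : ℝ≥0∞) < majorant φ x} := by
        rw [← hcs]
        gcongr
    _ = 3 * D * (c * unitMeasure {x | 3 * (c : ℝ≥0∞) < majorant φ x}) := by ring
    _ ≤ 3 * D * (3 * ∫⁻ u, φ u ∂unitMeasure) := by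
        exact mul_le_mul_right (mul_measure_majorant_gt_le hφm c) _
    _ = (9 * D : ℝ≥0) * eLpNorm f 1 unitMeasure := by
        rw [hint]
        push_cast
        ring

theorem eLpNorm_top_maximalFun_le {t : ℕ → ℕ → ℝ} (ht : IsTransformationMatrix t) {n : ℕ → ℕ}
    {B : ℝ≥0} (hB : ∀ b, upsilon t (n b) ≤ B) {f : ℝ → ℝ} (hf : MemLp f ∞ unitMeasure) :
    eLpNorm (maximalFun t n f) ∞ unitMeasure ≤
      (9 * (17 + B) : ℝ≥0) * eLpNorm f ∞ unitMeasure := by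
  have hm : AEMeasurable (fun u => ‖f u‖ₑ) unitMeasure := hf.aestronglyMeasurable.enorm
  have hφm : Measurable (hm.mk _) := hm.measurable_mk
  have hK : ∀ᵐ u ∂unitMeasure, hm.mk _ u ≤ eLpNorm f ∞ unitMeasure := by
    filter_upwards [hm.ae_eq_mk, enorm_ae_le_eLpNormEssSup f unitMeasure] with u hu hu'
    rw [← hu, eLpNorm_exponent_top]
    exact hu'
  rw [eLpNorm_exponent_top (f := maximalFun t n f)]
  refine essSup_le_of_ae_le _ (Filter.Eventually.of_forall fun x => ?_)
  simp only [enorm_eq_self]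
  refine iSup_le fun b => (enorm_absKernelMean_le hφm hm.ae_eq_mk ht (n b) x).trans ?_
  calc _ ≤ ENNReal.ofReal (17 + upsilon t (n b)) * (2 * eLpNorm f ∞ unitMeasure) := by
        gcongr
        exact majorant_le_of_ae_le hK x
    -- The factor 2 would suffice; 9 is taken to share the weak-type constant.
    _ ≤ (17 + B : ℝ≥0) * (9 * eLpNorm f ∞ unitMeasure) := by
        rw [← ENNReal.ofReal_coe_nnreal]
        have : 17 + upsilon t (n b) ≤ ((17 + B : ℝ≥0) : ℝ) := by
          push_cast
          linarith [hB b]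
        gcongr
        norm_num
    _ = _ := by
        push_cast
        ring

/-! ### The test function and the lower bound by the variation -/

/-- The normalized Dirichlet kernel, which is the indicator of the dyadic interval
`[0, 2 ^ (-k))`. -/
noncomputable def cylinderFun (k : ℕ) (x : ℝ) : ℝ := (2 ^ k)⁻¹ * dirichletKernel (2 ^ k) x

lemma cylinderFun_nonneg (k : ℕ) (x : ℝ) : 0 ≤ cylinderFun k x :=
  mul_nonneg (by positivity) ((isSign_radSeq x).signDirichlet_two_pow_nonneg k)

lemma cylinderFun_succ_le (k : ℕ) (x : ℝ) : cylinderFun (k + 1) x ≤ cylinderFun k x := by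
  have h : cylinderFun (k + 1) x = (1 + rademacher k x) / 2 * cylinderFun k x := by
    rw [cylinderFun, cylinderFun, dirichletKernel_eq, dirichletKernel_eq,
      (isSign_radSeq x).signDirichlet_two_pow_succ, pow_succ, mul_inv, radSeq]
    ring
  rw [h]
  refine mul_le_of_le_one_left (cylinderFun_nonneg k x) ?_
  have := (abs_le.mp (((isSign_radSeq x).abs_eq k).le)).2
  rw [radSeq] at this
  linarith

lemma cylinderFun_zero (x : ℝ) : cylinderFun 0 x = 1 := by
  simp [cylinderFun, dirichletKernel_eq]

/-- `|ε_k(n) - ε_{k+1}(n)|`. -/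
def digitJump (k n : ℕ) : ℝ := |(binCoeff k n : ℝ) - (binCoeff (k + 1) n : ℝ)|

lemma digitJump_nonneg (k n : ℕ) : 0 ≤ digitJump k n := abs_nonneg _

lemma digitJump_le_one (k n : ℕ) : digitJump k n ≤ 1 := by
  unfold digitJump
  have h1 : (binCoeff k n : ℝ) ≤ 1 := by exact_mod_cast binCoeff_le_one k n
  have h2 : (binCoeff (k + 1) n : ℝ) ≤ 1 := by exact_mod_cast binCoeff_le_one (k + 1) n
  have h3 : (0 : ℝ) ≤ binCoeff k n := Nat.cast_nonneg _
  have h4 : (0 : ℝ) ≤ binCoeff (k + 1) n := Nat.cast_nonneg _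
  exact abs_le.mpr ⟨by linarith, by linarith⟩

/-- The integer obtained from `n` by deleting the binary coefficients with index below `k`. -/
def truncBits (k n : ℕ) : ℕ := 2 ^ k * (n / 2 ^ k)

/-- A function bounded by one, whose pairing with the kernel `V_n` is large. -/
noncomputable def testFun (n : ℕ) (x : ℝ) : ℝ :=
  ∑ k ∈ Finset.range (Nat.log 2 n - 1), digitJump k n *
    ((cylinderFun (k + 1) x - cylinderFun (k + 2) x) * walsh (truncBits (k + 2) n) x)

/-- Differences of consecutive `cylinderFun`s are nonnegative and telescope; the other factors have
modulus at most 1. -/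
lemma abs_testFun_le_one (n : ℕ) (x : ℝ) : |testFun n x| ≤ 1 := by
  have htel : ∀ K, ∑ k ∈ Finset.range K, (cylinderFun (k + 1) x - cylinderFun (k + 2) x) =
      cylinderFun 1 x - cylinderFun (K + 1) x := fun K =>
    Finset.sum_range_sub' (fun k => cylinderFun (k + 1) x) K
  calc |testFun n x| ≤ ∑ k ∈ Finset.range (Nat.log 2 n - 1),
        (cylinderFun (k + 1) x - cylinderFun (k + 2) x) := by
        refine (Finset.abs_sum_le_sum_abs _ _).trans (Finset.sum_le_sum fun k _ => ?_)
        have h := sub_nonneg.mpr (cylinderFun_succ_le (k + 1) x)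
        rw [abs_mul, abs_mul, abs_walsh, mul_one, abs_of_nonneg h,
          abs_of_nonneg (digitJump_nonneg k n)]
        exact mul_le_of_le_one_left h (digitJump_le_one k n)
    _ ≤ 1 := by
        rw [htel]
        have h1 := cylinderFun_nonneg (Nat.log 2 n - 1 + 1) x
        have h2 := cylinderFun_succ_le 0 x
        rw [cylinderFun_zero] at h2
        linarith

lemma measurable_dirichletKernel (n : ℕ) : Measurable (dirichletKernel n) :=
  (measurable_signDirichlet n).comp measurable_radSeq

lemma measurable_testFun (n : ℕ) : Measurable (testFun n) := by
  have hc : ∀ k, Measurable (cylinderFun k) := fun k =>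
    (measurable_dirichletKernel _).const_mul _
  exact Finset.measurable_fun_sum _ fun k _ =>
    (((hc _).sub (hc _)).mul (measurable_walsh _)).const_mul _

lemma dirichletKernel_two_pow_mul_walsh (j q : ℕ) (x : ℝ) :
    dirichletKernel (2 ^ j) x * walsh (2 ^ j * q) x =
      ∑ a ∈ Finset.range (2 ^ j), walsh (2 ^ j * q + a) x := by
  rw [dirichletKernel, Finset.sum_mul]
  refine Finset.sum_congr rfl fun a ha => ?_
  rw [walsh_eq (2 ^ j * q + a), (isSign_radSeq x).signWalsh_add q (Finset.mem_range.mp ha),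
    mul_comm]
  rfl

lemma integrable_walsh_mul_walsh (m n : ℕ) :
    Integrable (fun x => walsh m x * walsh n x) unitMeasure := by
  simp only [walsh_mul_walsh]
  exact integrable_walsh _

lemma integrable_dirichletKernel_mul (j q i : ℕ) :
    Integrable (fun x => dirichletKernel (2 ^ j) x * walsh (2 ^ j * q) x * walsh i x)
      unitMeasure := by
  simp only [dirichletKernel_two_pow_mul_walsh, Finset.sum_mul]
  exact integrable_finsetSum _ fun a _ => integrable_walsh_mul_walsh _ _

lemma integral_dirichletKernel_mul (j q i : ℕ) :
    ∫ x, dirichletKernel (2 ^ j) x * walsh (2 ^ j * q) x * walsh i x ∂unitMeasure =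
      if i ∈ Finset.Ico (2 ^ j * q) (2 ^ j * q + 2 ^ j) then 1 else 0 := by
  simp only [dirichletKernel_two_pow_mul_walsh, Finset.sum_mul]
  rw [integral_finsetSum _ fun a _ => integrable_walsh_mul_walsh _ _]
  simp only [integral_walsh_mul_walsh]
  split_ifs with h
  · rw [Finset.mem_Ico] at h
    rw [Finset.sum_eq_single (i - 2 ^ j * q)]
    · rw [if_pos (by lia)]
    · intro a _ ha
      rw [if_neg (by lia)]
    · intro h'
      simp only [Finset.mem_range] at h'
      lia
  · refine Finset.sum_eq_zero fun a ha => if_neg fun h' => h ?_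
    rw [Finset.mem_range] at ha
    rw [Finset.mem_Ico]
    lia

/-- Since `truncBits (k + 2) n` is a multiple of both 2^{k+1} and 2^{k+2}, each product of D with
the Walsh function is a block of consecutive Walsh functions starting there. The coefficients are
thus ±2^{-(k+2)} times the jump, positive on the first half of the long block and negative on the
second. -/
lemma fourierCoeff_testFun (n i : ℕ) :
    fourierCoeff (testFun n) i = ∑ k ∈ Finset.range (Nat.log 2 n - 1), digitJump k n *
      ((2 ^ (k + 1))⁻¹ * (if i ∈ Finset.Ico (truncBits (k + 2) n)
          (truncBits (k + 2) n + 2 ^ (k + 1)) then 1 else 0) -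
        (2 ^ (k + 2))⁻¹ * (if i ∈ Finset.Ico (truncBits (k + 2) n)
          (truncBits (k + 2) n + 2 ^ (k + 2)) then 1 else 0)) := by
  have hT : ∀ k, truncBits (k + 2) n = 2 ^ (k + 1) * (2 * (n / 2 ^ (k + 2))) := fun k => by
    rw [truncBits, pow_succ _ (k + 1)]; ring
  have hT' : ∀ k, truncBits (k + 2) n = 2 ^ (k + 2) * (n / 2 ^ (k + 2)) := fun k => rfl
  have i1 : ∀ k, Integrable (fun x => dirichletKernel (2 ^ (k + 1)) x *
      walsh (truncBits (k + 2) n) x * walsh i x) unitMeasure := fun k => by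
    rw [hT]; exact integrable_dirichletKernel_mul _ _ _
  have i2 : ∀ k, Integrable (fun x => dirichletKernel (2 ^ (k + 2)) x *
      walsh (truncBits (k + 2) n) x * walsh i x) unitMeasure := fun k =>
    integrable_dirichletKernel_mul _ _ _
  have heq : ∀ x, testFun n x * walsh i x = ∑ k ∈ Finset.range (Nat.log 2 n - 1),
      digitJump k n * ((2 ^ (k + 1))⁻¹ * (dirichletKernel (2 ^ (k + 1)) x *
        walsh (truncBits (k + 2) n) x * walsh i x) -
        (2 ^ (k + 2))⁻¹ * (dirichletKernel (2 ^ (k + 2)) x *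
        walsh (truncBits (k + 2) n) x * walsh i x)) := fun x => by
    rw [testFun, Finset.sum_mul]
    refine Finset.sum_congr rfl fun k _ => ?_
    rw [cylinderFun, cylinderFun]
    ring
  unfold fourierCoeff
  simp only [heq]
  rw [integral_finsetSum _ fun k _ => by
    exact (((i1 k).const_mul _).sub ((i2 k).const_mul _)).const_mul _]
  refine Finset.sum_congr rfl fun k _ => ?_
  rw [integral_const_mul, integral_sub ((i1 k).const_mul _) ((i2 k).const_mul _),
    integral_const_mul, integral_const_mul]
  congr 3
  · rw [hT, integral_dirichletKernel_mul]
  · rw [hT', integral_dirichletKernel_mul]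

/-- The range of k stops at k + 2 = |n|, so the leading bit of n survives every truncation and all
blocks start at or above 2^{|n|}. The Hardy space pairing needs this. -/
lemma fourierCoeff_testFun_eq_zero {n i : ℕ} (hi : i < 2 ^ Nat.log 2 n) (hn : n ≠ 0) :
    fourierCoeff (testFun n) i = 0 := by
  rw [fourierCoeff_testFun]
  refine Finset.sum_eq_zero fun k hk => ?_
  rw [Finset.mem_range] at hk
  have hle : i < truncBits (k + 2) n := by
    refine hi.trans_le ?_
    have h1 : Nat.log 2 n = (k + 2) + (Nat.log 2 n - (k + 2)) := by lia
    rw [truncBits, h1, pow_add]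
    refine Nat.mul_le_mul_left _ ((Nat.le_div_iff_mul_le (by positivity)).mpr ?_)
    rw [← pow_add, add_comm, ← h1]
    exact Nat.pow_log_le_self 2 hn
  simp [hle.not_ge]

lemma sum_range_ite_mem_Ico (m b d : ℕ) :
    ∑ i ∈ Finset.range m, (if i ∈ Finset.Ico b (b + d) then 1 else 0 : ℝ) =
      (min (m - b) d : ℕ) := by
  rw [← Finset.sum_filter, Finset.sum_const, nsmul_one]
  congr 1
  have : (Finset.range m).filter (· ∈ Finset.Ico b (b + d)) = Finset.Ico b (min m (b + d)) := by
    ext i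
    simp only [Finset.mem_filter, Finset.mem_range, Finset.mem_Ico]
    lia
  rw [this, Nat.card_Ico]
  lia

lemma sum_fourierCoeff_testFun (n m : ℕ) :
    ∑ i ∈ Finset.range m, fourierCoeff (testFun n) i =
      ∑ k ∈ Finset.range (Nat.log 2 n - 1), digitJump k n * ((2 ^ (k + 2))⁻¹ *
        (2 * (min (m - truncBits (k + 2) n) (2 ^ (k + 1)) : ℕ) -
          (min (m - truncBits (k + 2) n) (2 ^ (k + 2)) : ℕ))) := by
  simp only [fourierCoeff_testFun]
  rw [Finset.sum_comm]
  refine Finset.sum_congr rfl fun k _ => ?_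
  rw [← Finset.mul_sum, Finset.sum_sub_distrib, ← Finset.mul_sum, ← Finset.mul_sum,
    sum_range_ite_mem_Ico, sum_range_ite_mem_Ico, pow_succ _ (k + 1)]
  field_simp

/-- The right side evaluates the tent s ↦ 2 min(s, 2^{k+1}) - min(s, 2^{k+2}) at s = n - l -
`truncBits (k + 2) n`. If the bits k and k+1 differ, n - `truncBits (k + 2) n` lies in [2^k, 3·2^k),
so the tent is at least 2^k - l; for l ≥ 2^k truncated subtraction makes this 0. -/
lemma digitJump_mul_le {n k l : ℕ} :
    digitJump k n * ((2 ^ (k + 2))⁻¹ * ((2 ^ k - l : ℕ) : ℝ)) ≤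
      digitJump k n * ((2 ^ (k + 2))⁻¹ *
        (2 * (min (n - l - truncBits (k + 2) n) (2 ^ (k + 1)) : ℕ) -
          (min (n - l - truncBits (k + 2) n) (2 ^ (k + 2)) : ℕ))) := by
  by_cases h0 : digitJump k n = 0
  · simp [h0]
  refine mul_le_mul_of_nonneg_left (mul_le_mul_of_nonneg_left ?_ (by positivity))
    (digitJump_nonneg k n)
  have hne : binCoeff k n ≠ binCoeff (k + 1) n := fun h => h0 (by simp [digitJump, h])
  have e1 := div_two_pow_eq k n
  have e2 := div_two_pow_eq (k + 1) n
  have e3 := Nat.div_add_mod n (2 ^ k)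
  have e4 : n % 2 ^ k < 2 ^ k := Nat.mod_lt _ (by positivity)
  have b1 := binCoeff_le_one k n
  have b2 := binCoeff_le_one (k + 1) n
  have e5 : n = truncBits (k + 2) n +
      (2 * (2 ^ k * binCoeff (k + 1) n) + 2 ^ k * binCoeff k n + n % 2 ^ k) := by
    rw [e1, e2] at e3
    conv_lhs => rw [← e3]
    rw [truncBits, pow_add 2 k 2]
    ring
  have p1 : 2 ^ (k + 1) = 2 * 2 ^ k := by ring
  have p2 : 2 ^ (k + 2) = 4 * 2 ^ k := by ring
  have hnat : (2 ^ k - l) + min (n - l - truncBits (k + 2) n) (2 ^ (k + 2)) ≤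
      2 * min (n - l - truncBits (k + 2) n) (2 ^ (k + 1)) := by
    rw [p1, p2]
    generalize truncBits (k + 2) n = b at *
    rcases Nat.le_one_iff_eq_zero_or_eq_one.mp b1 with h1 | h1 <;>
    rcases Nat.le_one_iff_eq_zero_or_eq_one.mp b2 with h2 | h2
    · exact absurd (h1.trans h2.symm) hne
    · rw [h1, h2, mul_one, mul_zero] at e5
      lia
    · rw [h1, h2, mul_one, mul_zero] at e5
      lia
    · exact absurd (h1.trans h2.symm) hne
  have : ((2 ^ k - l : ℕ) : ℝ) + (min (n - l - truncBits (k + 2) n) (2 ^ (k + 2)) : ℕ) ≤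
      2 * (min (n - l - truncBits (k + 2) n) (2 ^ (k + 1)) : ℕ) := by exact_mod_cast hnat
  linarith

/-- Chebyshev's sum inequality for two decreasing sequences; K/2 is the mean of K - l. -/
lemma half_mul_sum_le {a : ℕ → ℝ} (ha : Antitone a) (K : ℕ) :
    (K : ℝ) / 2 * ∑ l ∈ Finset.range (K + 1), a l ≤
      ∑ l ∈ Finset.range (K + 1), a l * ((K - l : ℕ) : ℝ) := by
  have hg : Antitone fun l : ℕ => ((K - l : ℕ) : ℝ) := fun i j hij =>
    Nat.cast_le.mpr (Nat.sub_le_sub_left hij K)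
  have h := ((ha.monovary hg).monovaryOn (Finset.range (K + 1) : Set ℕ)).sum_mul_sum_le_card_mul_sum
  have hsum : ∑ l ∈ Finset.range (K + 1), ((K - l : ℕ) : ℝ) = K * (K + 1) / 2 := by
    have h1 := Finset.sum_range_reflect (fun l : ℕ => (l : ℝ)) (K + 1)
    simp only [add_tsub_cancel_right] at h1
    rw [h1]
    have h2 := Finset.sum_range_id_mul_two (K + 1)
    have h3 : (∑ i ∈ Finset.range (K + 1), (i : ℝ)) * 2 = (K + 1) * K := by
      have := congrArg (Nat.cast : ℕ → ℝ) h2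
      push_cast [add_tsub_cancel_right] at this
      exact this
    linarith
  rw [hsum, Finset.card_range] at h
  push_cast at h
  have hK : (0 : ℝ) < K + 1 := by positivity
  refine le_of_mul_le_mul_left ?_ hK
  calc _ = (∑ l ∈ Finset.range (K + 1), a l) * (K * (K + 1) / 2) := by ring
    _ ≤ _ := h

/-- The pairing of the test function with the kernel `V_n`. -/
noncomputable def testPairing (t : ℕ → ℕ → ℝ) (n : ℕ) : ℝ :=
  ∑ m ∈ Finset.range (n + 1), t (n - m) n *
    ∑ i ∈ Finset.range m, fourierCoeff (testFun n) i

/-- The 8 comes from 2^{-(k+2)} · 2^k/2 = 1/8. The 2 covers k = |n|-1 and k = |n|, which the test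
function omits; each of those terms is at most 1. -/
lemma upsilon_le {t : ℕ → ℕ → ℝ} (ht : IsTransformationMatrix t) {n : ℕ} (hn : n ≠ 0) :
    upsilon t n ≤ 8 * testPairing t n + 2 := by
  have hanti : Antitone (t · n) := antitone_nat_of_succ_le (ht.antitone · n)
  have htau0 : ∀ s, 0 ≤ tau t s n := fun s => Finset.sum_nonneg fun l _ => ht.nonneg l n
  have hlow : ∑ k ∈ Finset.range (Nat.log 2 n - 1), digitJump k n * tau t (2 ^ k) n ≤
      8 * testPairing t n := by
    have hrefl : testPairing t n = ∑ l ∈ Finset.range (n + 1), t l n *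
        ∑ i ∈ Finset.range (n - l), fourierCoeff (testFun n) i := by
      rw [testPairing, ← Finset.sum_range_reflect]
      refine Finset.sum_congr rfl fun l hl => ?_
      rw [Finset.mem_range] at hl
      rw [show n + 1 - 1 - l = n - l by lia, show n - (n - l) = l by lia]
    have h1 : ∑ l ∈ Finset.range (n + 1), t l n * ∑ k ∈ Finset.range (Nat.log 2 n - 1),
        digitJump k n * ((2 ^ (k + 2))⁻¹ * ((2 ^ k - l : ℕ) : ℝ)) ≤ testPairing t n := by
      rw [hrefl]
      refine Finset.sum_le_sum fun l _ => mul_le_mul_of_nonneg_left ?_ (ht.nonneg l n)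
      rw [sum_fourierCoeff_testFun]
      exact Finset.sum_le_sum fun k _ => digitJump_mul_le
    have h2 : ∑ k ∈ Finset.range (Nat.log 2 n - 1), digitJump k n * (8⁻¹ * tau t (2 ^ k) n) ≤
        ∑ l ∈ Finset.range (n + 1), t l n * ∑ k ∈ Finset.range (Nat.log 2 n - 1),
          digitJump k n * ((2 ^ (k + 2))⁻¹ * ((2 ^ k - l : ℕ) : ℝ)) := by
      simp only [Finset.mul_sum (Finset.range (Nat.log 2 n - 1))]
      rw [Finset.sum_comm]
      refine Finset.sum_le_sum fun k hk => ?_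
      rw [Finset.mem_range] at hk
      have hkn : 2 ^ k ≤ n :=
        (Nat.pow_le_pow_right two_pos (by lia)).trans (Nat.pow_log_le_self 2 hn)
      have h3 := half_mul_sum_le hanti (2 ^ k)
      calc digitJump k n * (8⁻¹ * tau t (2 ^ k) n)
          = digitJump k n * ((2 ^ (k + 2))⁻¹ *
            (((2 ^ k : ℕ) : ℝ) / 2 * ∑ l ∈ Finset.range (2 ^ k + 1), t l n)) := by
            rw [tau, pow_add]
            push_cast
            field_simp
            ring
        _ ≤ digitJump k n * ((2 ^ (k + 2))⁻¹ *
            ∑ l ∈ Finset.range (2 ^ k + 1), t l n * ((2 ^ k - l : ℕ) : ℝ)) := by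
            refine mul_le_mul_of_nonneg_left (mul_le_mul_of_nonneg_left h3 (by positivity))
              (digitJump_nonneg k n)
        _ ≤ digitJump k n * ((2 ^ (k + 2))⁻¹ *
            ∑ l ∈ Finset.range (n + 1), t l n * ((2 ^ k - l : ℕ) : ℝ)) := by
            refine mul_le_mul_of_nonneg_left (mul_le_mul_of_nonneg_left ?_ (by positivity))
              (digitJump_nonneg k n)
            exact Finset.sum_le_sum_of_subset_of_nonneg (Finset.range_mono (by lia))
              fun l _ _ => mul_nonneg (ht.nonneg l n) (Nat.cast_nonneg _)
        _ = _ := by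
            rw [Finset.mul_sum, Finset.mul_sum]
            exact Finset.sum_congr rfl fun l _ => by ring
    have h4 : ∑ k ∈ Finset.range (Nat.log 2 n - 1), digitJump k n * (8⁻¹ * tau t (2 ^ k) n) =
        8⁻¹ * ∑ k ∈ Finset.range (Nat.log 2 n - 1), digitJump k n * tau t (2 ^ k) n := by
      rw [Finset.mul_sum]
      exact Finset.sum_congr rfl fun k _ => by ring
    rw [h4] at h2
    linarith
  have hterm : ∀ k ≤ Nat.log 2 n, digitJump k n * tau t (2 ^ k) n ≤ 1 := fun k hk => by
    have hkn : 2 ^ k ≤ n := (Nat.pow_le_pow_right two_pos hk).trans (Nat.pow_log_le_self 2 hn)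
    refine mul_le_one₀ (digitJump_le_one k n) (htau0 _) ?_
    rw [← ht.sum_eq_one n]
    exact Finset.sum_le_sum_of_subset_of_nonneg (Finset.range_mono (by lia))
      fun l _ _ => ht.nonneg l n
  have hup : upsilon t n = ∑ k ∈ Finset.range (Nat.log 2 n + 1),
      digitJump k n * tau t (2 ^ k) n := rfl
  rcases Nat.eq_zero_or_pos (Nat.log 2 n) with h | h
  · rw [h] at hup hlow
    rw [hup]
    simp only [zero_add, Finset.sum_range_one]
    have := hterm 0 (Nat.zero_le _)
    simp at hlow
    linarith
  · obtain ⟨N, hN⟩ := Nat.exists_eq_add_one.mpr h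
    rw [hN, Nat.add_sub_cancel] at hlow
    rw [hup, hN, Finset.sum_range_succ, Finset.sum_range_succ]
    have := hterm N (by lia)
    have := hterm (N + 1) (by lia)
    linarith

/-! ### Operator norms control the test pairing -/

lemma upsilon_zero (t : ℕ → ℕ → ℝ) : upsilon t 0 = 0 := by
  simp [upsilon, binCoeff]

/-- Where the first n digits vanish, all Walsh functions involved equal 1 and the mean of the test
function equals the pairing. This set is not null because D_{2^n}, supported there, has integral 1.
-/
lemma testPairing_le_of_Linfty {t : ℕ → ℕ → ℝ} {n : ℕ} {M : ℝ≥0}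
    (h : opNormLinfty (weightedMean t n) ≤ M) : testPairing t n ≤ M + 1 := by
  -- The slack 1 provides an admissible constant K < M + 1 without showing that the infimum is
  -- attained.
  obtain ⟨K, hK, hKM⟩ := sInf_lt_iff.mp
    (h.trans_lt (ENNReal.lt_add_right ENNReal.coe_ne_top one_ne_zero))
  have hg : MemLp (testFun n) ∞ unitMeasure :=
    memLp_top_of_bound (measurable_testFun n).aestronglyMeasurable 1
      (Filter.Eventually.of_forall fun x => abs_testFun_le_one n x)
  have hg1 : eLpNorm (testFun n) ∞ unitMeasure ≤ 1 := by
    rw [eLpNorm_exponent_top]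
    refine (eLpNormEssSup_le_of_ae_bound (C := 1)
      (Filter.Eventually.of_forall fun x => abs_testFun_le_one n x)).trans ?_
    simp
  have hb : eLpNormEssSup (weightedMean t n (testFun n)) unitMeasure ≤ ((M + 1 : ℝ≥0) : ℝ≥0∞) := by
    rw [← eLpNorm_exponent_top]
    refine (hK _ hg).trans ?_
    push_cast
    calc _ ≤ ((M : ℝ≥0∞) + 1) * 1 := by gcongr
      _ = _ := mul_one _
  have hae : ∀ᵐ x ∂unitMeasure, |weightedMean t n (testFun n) x| ≤ M + 1 := by
    filter_upwards [enorm_ae_le_eLpNormEssSup (weightedMean t n (testFun n)) unitMeasure] with x hx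
    have h1 : ‖weightedMean t n (testFun n) x‖₊ ≤ M + 1 := ENNReal.coe_le_coe.mp (hx.trans hb)
    exact_mod_cast h1
  by_contra hcon
  have h1 : IsSign (1 : ℕ → ℝ) := fun k => Or.inl rfl
  have hzero : ∀ᵐ x ∂unitMeasure,
      ENNReal.ofReal (signDirichlet (2 ^ n) (1 * radSeq x)) = 0 := by
    filter_upwards [hae] with x hx
    by_contra hne
    refine hcon ((le_abs_self _).trans (le_trans (le_of_eq ?_) hx))
    have hr := (h1.mul (isSign_radSeq x)).eq_one_of_signDirichlet_ne_zero (m := n)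
      fun h0 => hne (by rw [h0, ENNReal.ofReal_zero])
    rw [one_mul] at hr
    congr 1
    refine Finset.sum_congr rfl fun m hm => ?_
    rw [partialSum]
    congr 1
    refine Finset.sum_congr rfl fun i hi => ?_
    have hin : i < 2 ^ n := by
      rw [Finset.mem_range] at hm hi
      have := Nat.lt_two_pow_self (n := n)
      lia
    rw [walsh_eq, signWalsh_eq_prod hin, Finset.prod_eq_one fun k hk => by
      rw [hr k (Finset.mem_range.mp hk), one_pow], mul_one]
  have := lintegral_signDirichlet_two_pow h1 n
  rw [lintegral_congr_ae hzero, lintegral_zero] at this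
  exact zero_ne_one this

/-- The dyadic block `∑_{2^N ≤ i < 2^{N+1}} w_i`, an element of the unit ball of the dyadic Hardy
space. -/
noncomputable def walshBlock (N : ℕ) (x : ℝ) : ℝ :=
  ∑ i ∈ Finset.Ico (2 ^ N) (2 ^ (N + 1)), walsh i x

lemma fourierCoeff_walshBlock (N k : ℕ) :
    fourierCoeff (walshBlock N) k = if k ∈ Finset.Ico (2 ^ N) (2 ^ (N + 1)) then 1 else 0 := by
  unfold fourierCoeff walshBlock
  simp only [Finset.sum_mul]
  rw [integral_finsetSum _ fun i _ => integrable_walsh_mul_walsh i k]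
  simp only [integral_walsh_mul_walsh]
  rw [Finset.sum_ite_eq']

lemma walshBlock_eq (N : ℕ) (x : ℝ) :
    walshBlock N x = rademacher N x * dirichletKernel (2 ^ N) x := by
  have h1 := (isSign_radSeq x).signDirichlet_two_pow_succ N
  rw [walshBlock, Finset.sum_Ico_eq_sub _ (Nat.pow_le_pow_right two_pos (Nat.le_succ N))]
  change signDirichlet (2 ^ (N + 1)) (radSeq x) - signDirichlet (2 ^ N) (radSeq x) = _
  rw [h1, dirichletKernel_eq]
  change _ = radSeq x N * _
  ring

lemma partialSum_walshBlock (N m : ℕ) (x : ℝ) :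
    partialSum (2 ^ m) (walshBlock N) x = if m ≤ N then 0 else walshBlock N x := by
  rw [partialSum]
  simp only [fourierCoeff_walshBlock, ite_mul, one_mul, zero_mul]
  split_ifs with h
  · refine Finset.sum_eq_zero fun k hk => if_neg fun hk' => ?_
    have h1 := Finset.mem_range.mp hk
    have h2 := (Finset.mem_Ico.mp hk').1
    have h3 := Nat.pow_le_pow_right two_pos h
    lia
  · rw [← Finset.sum_filter, walshBlock]
    refine Finset.sum_congr ?_ fun _ _ => rfl
    ext k
    have h3 : 2 ^ (N + 1) ≤ 2 ^ m := Nat.pow_le_pow_right two_pos (by lia)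
    simp only [Finset.mem_filter, Finset.mem_range, Finset.mem_Ico]
    lia

/-- Each dyadic partial sum is 0 or the whole block, whose modulus is D_{2^N}. -/
lemma hardyNorm_walshBlock_le (N : ℕ) : hardyNorm (walshBlock N) ≤ 1 := by
  have h1 : IsSign (1 : ℕ → ℝ) := fun k => Or.inl rfl
  rw [← lintegral_signDirichlet_two_pow h1 N]
  refine lintegral_mono fun x => iSup_le fun m => ?_
  have h2 := (isSign_radSeq x).signDirichlet_two_pow_nonneg N
  rw [partialSum_walshBlock]
  split_ifs
  · simp
  · rw [walshBlock_eq, enorm_mul, one_mul, dirichletKernel_eq, Real.enorm_of_nonneg h2,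
      ← ofReal_norm, Real.norm_eq_abs]
    have h3 : |rademacher N x| = 1 := (isSign_radSeq x).abs_eq N
    rw [h3, ENNReal.ofReal_one, one_mul]

lemma memHardy_walshBlock (N : ℕ) : MemHardy (walshBlock N) :=
  ⟨integrable_finsetSum _ fun i _ => integrable_walsh i,
    (hardyNorm_walshBlock_le N).trans_lt ENNReal.one_lt_top⟩

lemma integral_weightedMean_mul (t : ℕ → ℕ → ℝ) (n : ℕ) (f : ℝ → ℝ) {g : ℝ → ℝ}
    (hg : Integrable g unitMeasure) :
    ∫ x, weightedMean t n f x * g x ∂unitMeasure = ∑ m ∈ Finset.range (n + 1), t (n - m) n *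
      ∑ k ∈ Finset.range m, fourierCoeff f k * fourierCoeff g k := by
  have hint : ∀ k, Integrable (fun x => g x * walsh k x) unitMeasure := fun k =>
    hg.mul_bdd (c := 1) (measurable_walsh k).aestronglyMeasurable
      (Filter.Eventually.of_forall fun x => (abs_walsh k x).le)
  have heq : ∀ x, weightedMean t n f x * g x = ∑ m ∈ Finset.range (n + 1), t (n - m) n *
      ∑ k ∈ Finset.range m, fourierCoeff f k * (g x * walsh k x) := fun x => by
    rw [weightedMean, Finset.sum_mul]
    refine Finset.sum_congr rfl fun m _ => ?_
    rw [partialSum, mul_assoc, Finset.sum_mul]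
    congr 1
    exact Finset.sum_congr rfl fun k _ => by ring
  simp only [heq]
  rw [integral_finsetSum _ fun m _ => (integrable_finsetSum _ fun k _ =>
    (hint k).const_mul _).const_mul _]
  refine Finset.sum_congr rfl fun m _ => ?_
  rw [integral_const_mul, integral_finsetSum _ fun k _ => (hint k).const_mul _]
  congr 1
  exact Finset.sum_congr rfl fun k _ => integral_const_mul _ _

/-- The block has coefficient 1 at every frequency below n where the test function has a nonzero
one, so integrating its mean against the test function gives the pairing. -/
lemma testPairing_le_of_hardy {t : ℕ → ℕ → ℝ} {n : ℕ} (hn : n ≠ 0) {M : ℝ≥0}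
    (h : opNormHardyL1 (weightedMean t n) ≤ M) : testPairing t n ≤ M + 1 := by
  obtain ⟨K, hK, hKM⟩ := sInf_lt_iff.mp
    (h.trans_lt (ENNReal.lt_add_right ENNReal.coe_ne_top one_ne_zero))
  set N := Nat.log 2 n with hN
  set T := weightedMean t n (walshBlock N) with hT
  have hb : ∫⁻ x, ‖T x‖ₑ ∂unitMeasure ≤ ((M + 1 : ℝ≥0) : ℝ≥0∞) := by
    rw [← eLpNorm_one_eq_lintegral_enorm]
    refine (hK _ (memHardy_walshBlock N)).trans ?_
    push_cast
    calc _ ≤ ((M : ℝ≥0∞) + 1) * 1 := by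
          gcongr
          exact hardyNorm_walshBlock_le N
      _ = _ := mul_one _
  have hg : Integrable (testFun n) unitMeasure :=
    Integrable.of_bound (measurable_testFun n).aestronglyMeasurable 1
      (Filter.Eventually.of_forall fun x => abs_testFun_le_one n x)
  have hpair : testPairing t n = ∫ x, T x * testFun n x ∂unitMeasure := by
    rw [hT, integral_weightedMean_mul t n _ hg, testPairing]
    refine Finset.sum_congr rfl fun m hm => ?_
    congr 1
    refine Finset.sum_congr rfl fun k hk => ?_
    rw [Finset.mem_range] at hm hk
    rw [fourierCoeff_walshBlock]
    split_ifs with hkN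
    · rw [one_mul]
    · rw [zero_mul]
      refine fourierCoeff_testFun_eq_zero ?_ hn
      by_contra hcon
      refine hkN (Finset.mem_Ico.mpr ⟨not_lt.mp hcon, ?_⟩)
      have := Nat.lt_pow_succ_log_self one_lt_two n
      rw [← hN] at this
      lia
  have henorm : ‖testPairing t n‖ₑ ≤ ((M + 1 : ℝ≥0) : ℝ≥0∞) := by
    rw [hpair]
    refine (enorm_integral_le_lintegral_enorm _).trans (le_trans (lintegral_mono fun x => ?_) hb)
    rw [enorm_mul]
    refine mul_le_of_le_one_right' ?_
    rw [← ofReal_norm]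
    exact ENNReal.ofReal_le_one.mpr (abs_testFun_le_one n x)
  have h1 : ‖testPairing t n‖₊ ≤ M + 1 := ENNReal.coe_le_coe.mp henorm
  exact (le_abs_self _).trans (by exact_mod_cast h1)

lemma upsilon_le_of_opNorm_le {t : ℕ → ℕ → ℝ} (ht : IsTransformationMatrix t) {n : ℕ} {M : ℝ≥0}
    (h : opNormHardyL1 (weightedMean t n) ≤ M ∨ opNormLinfty (weightedMean t n) ≤ M) :
    upsilon t n ≤ (8 * M + 10 : ℝ≥0) := by
  push_cast
  rcases eq_or_ne n 0 with rfl | hn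
  · rw [upsilon_zero]
    positivity
  · have h1 := upsilon_le ht hn
    have h2 : testPairing t n ≤ M + 1 :=
      h.elim (testPairing_le_of_hardy hn) testPairing_le_of_Linfty
    linarith

end WalshPaley

theorem proposition1 (M : ℝ≥0) :
    ∃ C : ℝ≥0, ∀ (t : ℕ → ℕ → ℝ) (n : ℕ → ℕ),
      WalshPaley.IsTransformationMatrix t →
      ((⨆ a : ℕ, WalshPaley.opNormHardyL1 (WalshPaley.weightedMean t (n a))) ≤ (M : ℝ≥0∞) ∨
        (⨆ a : ℕ, WalshPaley.opNormLinfty (WalshPaley.weightedMean t (n a))) ≤ (M : ℝ≥0∞) ∨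
        (⨆ a : ℕ, ENNReal.ofReal (WalshPaley.upsilon t (n a))) ≤ (M : ℝ≥0∞)) →
      (∀ f : ℝ → ℝ, Integrable f WalshPaley.unitMeasure →
        WalshPaley.weakL1Norm (WalshPaley.maximalFun t n f) ≤
          (C : ℝ≥0∞) * eLpNorm f 1 WalshPaley.unitMeasure) ∧
      (∀ f : ℝ → ℝ, MemLp f ∞ WalshPaley.unitMeasure →
        eLpNorm (WalshPaley.maximalFun t n f) ∞ WalshPaley.unitMeasure ≤
          (C : ℝ≥0∞) * eLpNorm f ∞ WalshPaley.unitMeasure) := by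
  -- Here 8M + 10 = 8(M + 1) + 2 bounds υ under either norm hypothesis, and it exceeds M in the
  -- third case.
  refine ⟨9 * (17 + (8 * M + 10)), fun t n ht h => ?_⟩
  have hB : ∀ b, WalshPaley.upsilon t (n b) ≤ (8 * M + 10 : ℝ≥0) := fun b => by
    rcases h with h | h | h
    · exact WalshPaley.upsilon_le_of_opNorm_le ht (Or.inl (iSup_le_iff.mp h b))
    · exact WalshPaley.upsilon_le_of_opNorm_le ht (Or.inr (iSup_le_iff.mp h b))
    · have h1 := iSup_le_iff.mp h b
      rw [← ENNReal.ofReal_coe_nnreal, ENNReal.ofReal_le_ofReal_iff M.coe_nonneg] at h1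
      push_cast
      have := M.coe_nonneg
      linarith
  exact ⟨fun f hf => WalshPaley.weakL1Norm_maximalFun_le ht hB hf,
    fun f hf => WalshPaley.eLpNorm_top_maximalFun_le ht hB hf⟩
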